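/- For $n\ge 1$ let $\mathbf F_n$ be the free lattice on $n$ generators. Let $\operatorname{Id}(\mathbf F_n)$ be the lattice of its (nonempty) ideals, and let $\operatorname{DM}(\mathbf F_n)$ be its Dedekind–MacNeille completion, i.e. the set of all $C\subseteq \mathbf F_n$ that equal the set of lower bounds of the set of upper bounds of $C$; both are ordered by inclusion. Let $\mathbf L$ be a lattice. A join cover of $a\in\mathbf L$ is a finite nonempty $V\subseteq\mathbf L$ with $a\le\bigvee V$; it is nontrivial if $a\not\le v$ for all $v\in V$. Let $D_0(\mathbf L)$ be the set of elements without nontrivial join covers, and let $D_{k+1}(\mathbf L)$ be the set of those $a$ such that for every nontrivial join cover $V$ of $a$ there is a join cover $U\subseteq D_k(\mathbf L)$ of $a$ each of whose members lies below a member of $V$. We say that $\mathbf L$ has $D$-rank $\le k$ if every element of $\mathbf L$ that is not the join of two strictly smaller elements lies in $D_k(\mathbf L)$. A finitely generated lattice $\mathbf L$ is lower bounded if for every homomorphism $f:\mathbf K\to\mathbf L$ with $\mathbf K$ a finitely generated lattice and every $a\in \mathbf L$, the set $\{u\in \mathbf K: f(u)\ge a\}$ is empty or has a least element. Upper bounded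 lattices and the dual $D$-rank are defined dually. Let $\mathcal V_k$ be the variety of all lattices whose finitely generated sublattices are lower and upper bounded, of $D$-rank and dual $D$-rank $\le k$; let $\mathbf B_{(n,k)}$ be the free lattice on $n$ generators in $\mathcal V_k$, and let the profinite-bounded completion $\mathbf H_n$ of $\mathbf F_n$ be the inverse limit of the lattices $\mathbf B_{(n,k)}$ $(k<\omega)$ under the canonical maps $\mathbf B_{(n,l)}\to\mathbf B_{(n,k)}$, $k\le l$. Consider the conditions - $\mathrm{(W)}$: $s\wedge t\le u\vee v$ implies $s\le u\vee v$ or $t\le u\vee v$ or $s\wedge t\le u$ or $s\wedge t\le v$; - $\mathrm{SD}_\vee$: $x\vee y=x\vee z$ implies $x\vee y=x\vee(y\wedge z)$; - $\mathrm{SD}_\wedge$: $x\wedge y=x\wedge z$ implies $x\wedge y=x\wedge(y\vee z)$. Then: 1. For every $n\ge 1$, $\operatorname{Id}(\mathbf F_n)$ satisfies $\mathrm{(W)}$ and $\mathrm{SD}_\vee$; for every $n\ge 3$ it fails $\mathrm{SD}_\wedge$. 2. For every $n\ge 1$, $\mathbf H_n\cong\operatorname{DM}(\mathbf F_n)$,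 and $\mathbf H_n$ satisfies $\mathrm{(W)}$, $\mathrm{SD}_\vee$ and $\mathrm{SD}_\wedge$. 3. For every $n\ge 3$, $\operatorname{Id}(\mathbf F_n)$ and $\operatorname{DM}(\mathbf F_n)$ are not elementarily equivalent in the first-order language $\{\vee,\wedge\}$ of lattices. 4. Let $x,y,z$ be the generators of $\mathbf F_3$, let $y_0=y$, $z_0=z$, $y_{k+1}=y\vee(x\wedge z_k)$, $z_{k+1}=z\vee(x\wedge y_k)$, and let $X=\{w: w\le x\}$, $Y=\bigcup_{k\ge0}\{w: w\le y_k\}$, $Z=\bigcup_{k\ge0}\{w: w\le z_k\}$. Then $X,Y,Z$ are ideals of $\mathbf F_3$ with $X\wedge Y=X\wedge Z<X\wedge(Y\vee Z)$ in $\operatorname{Id}(\mathbf F_3)$, and $x\wedge(y\vee z)$ belongs to $X\wedge(Y\vee Z)$ but neither to $X\wedge Y$ nor to $X\wedge Z$. -/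

import Mathlib

/-! ### Free lattices -/

/-- Lattice terms over a set of variables. -/
inductive LatticeTerm (α : Type*) : Type _
  | var : α → LatticeTerm α
  | sup : LatticeTerm α → LatticeTerm α → LatticeTerm α
  | inf : LatticeTerm α → LatticeTerm α → LatticeTerm α

namespace LatticeTerm

/-- The inequalities between lattice terms that are derivable from the axioms of lattices. -/
inductive Le {α : Type*} : LatticeTerm α → LatticeTerm α → Prop
  | refl (s : LatticeTerm α) : Le s s
  | trans {s t u : LatticeTerm α} : Le s t → Le t u → Le s u
  | le_sup_left (s t : LatticeTerm α) : Le s (sup s t)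
  | le_sup_right (s t : LatticeTerm α) : Le t (sup s t)
  | sup_le {s t u : LatticeTerm α} : Le s u → Le t u → Le (sup s t) u
  | inf_le_left (s t : LatticeTerm α) : Le (inf s t) s
  | inf_le_right (s t : LatticeTerm α) : Le (inf s t) t
  | le_inf {s t u : LatticeTerm α} : Le s t → Le s u → Le s (inf t u)

instance {α : Type*} : Preorder (LatticeTerm α) where
  le := Le
  le_refl := Le.refl
  le_trans _ _ _ := Le.trans

/-- The value of a term in a lattice under an assignment of the variables. -/
def eval {α L : Type*} [Lattice L] (g : α → L) : LatticeTerm α → L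
  | var a => g a
  | sup s t => eval g s ⊔ eval g t
  | inf s t => eval g s ⊓ eval g t

theorem eval_mono {α L : Type*} [Lattice L] (g : α → L) {s t : LatticeTerm α} (h : s ≤ t) :
    eval g s ≤ eval g t := by
  induction (show Le s t from h) with
  | refl s => exact _root_.le_refl _
  | trans h₁ h₂ ih₁ ih₂ => exact (ih₁ h₁).trans (ih₂ h₂)
  | le_sup_left s t => exact _root_.le_sup_left
  | le_sup_right s t => exact _root_.le_sup_right
  | sup_le h₁ h₂ ih₁ ih₂ => exact _root_.sup_le (ih₁ h₁) (ih₂ h₂)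
  | inf_le_left s t => exact _root_.inf_le_left
  | inf_le_right s t => exact _root_.inf_le_right
  | le_inf h₁ h₂ ih₁ ih₂ => exact _root_.le_inf (ih₁ h₁) (ih₂ h₂)

end LatticeTerm

/-- The free lattice on `α`: lattice terms modulo derivable equality. -/
def FreeLattice (α : Type*) : Type _ := Antisymmetrization (LatticeTerm α) (· ≤ ·)

namespace FreeLattice

/-- The class of a term. -/
def mk {α : Type*} (t : LatticeTerm α) : FreeLattice α := toAntisymmetrization (· ≤ ·) t

/-- The generators of the free lattice. -/
def of {α : Type*} (a : α) : FreeLattice α := mk (LatticeTerm.var a)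

instance {α : Type*} : PartialOrder (FreeLattice α) :=
  inferInstanceAs (PartialOrder (Antisymmetrization (LatticeTerm α) (· ≤ ·)))

theorem mk_le_mk {α : Type*} {s t : LatticeTerm α} : mk s ≤ mk t ↔ s ≤ t := Iff.rfl

instance {α : Type*} : Lattice (FreeLattice α) where
  sup := Quotient.map₂ LatticeTerm.sup fun _ _ h₁ _ _ h₂ =>
    ⟨.sup_le (.trans h₁.1 (.le_sup_left _ _)) (.trans h₂.1 (.le_sup_right _ _)),
      .sup_le (.trans h₁.2 (.le_sup_left _ _)) (.trans h₂.2 (.le_sup_right _ _))⟩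
  inf := Quotient.map₂ LatticeTerm.inf fun _ _ h₁ _ _ h₂ =>
    ⟨.le_inf (.trans (.inf_le_left _ _) h₁.1) (.trans (.inf_le_right _ _) h₂.1),
      .le_inf (.trans (.inf_le_left _ _) h₁.2) (.trans (.inf_le_right _ _) h₂.2)⟩
  le_sup_left := by rintro ⟨s⟩ ⟨t⟩; exact LatticeTerm.Le.le_sup_left s t
  le_sup_right := by rintro ⟨s⟩ ⟨t⟩; exact LatticeTerm.Le.le_sup_right s t
  sup_le := by rintro ⟨s⟩ ⟨t⟩ ⟨u⟩ h₁ h₂; exact LatticeTerm.Le.sup_le h₁ h₂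
  inf_le_left := by rintro ⟨s⟩ ⟨t⟩; exact LatticeTerm.Le.inf_le_left s t
  inf_le_right := by rintro ⟨s⟩ ⟨t⟩; exact LatticeTerm.Le.inf_le_right s t
  le_inf := by rintro ⟨s⟩ ⟨t⟩ ⟨u⟩ h₁ h₂; exact LatticeTerm.Le.le_inf h₁ h₂

/-- The universal property of the free lattice. -/
theorem existsUnique_lift {α L : Type*} [Lattice L] (g : α → L) :
    ∃! f : LatticeHom (FreeLattice α) L, ∀ a, f (of a) = g a := by
  refine ⟨{ toFun := Quotient.lift (LatticeTerm.eval g) fun s t h =>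
              le_antisymm (LatticeTerm.eval_mono g h.1) (LatticeTerm.eval_mono g h.2)
            map_sup' := by rintro ⟨s⟩ ⟨t⟩; rfl
            map_inf' := by rintro ⟨s⟩ ⟨t⟩; rfl }, fun a => rfl, fun f hf => ?_⟩
  apply DFunLike.ext
  rintro ⟨t⟩
  change f (mk t) = LatticeTerm.eval g t
  induction t with
  | var a => exact hf a
  | sup s t hs ht =>
    rw [LatticeTerm.eval, ← hs, ← ht, ← map_sup]
    rfl
  | inf s t hs ht =>
    rw [LatticeTerm.eval, ← hs, ← ht, ← map_inf]
    rfl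

end FreeLattice

/-! ### Whitman's condition and semidistributivity -/

/-- Whitman's condition (W). -/
def WhitmanCondition (L : Type*) [Lattice L] : Prop :=
  ∀ s t u v : L, s ⊓ t ≤ u ⊔ v → s ≤ u ⊔ v ∨ t ≤ u ⊔ v ∨ s ⊓ t ≤ u ∨ s ⊓ t ≤ v

/-- Join semidistributivity. -/
def JoinSemidistributive (L : Type*) [Lattice L] : Prop :=
  ∀ x y z : L, x ⊔ y = x ⊔ z → x ⊔ y = x ⊔ (y ⊓ z)

/-- Meet semidistributivity. -/
def MeetSemidistributive (L : Type*) [Lattice L] : Prop :=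
  ∀ x y z : L, x ⊓ y = x ⊓ z → x ⊓ y = x ⊓ (y ⊔ z)

/-! ### Bounded lattices and `D`-rank -/

/-- `V` is a join cover of `a`: a finite nonempty set whose join is above `a`. -/
def IsJoinCover {L : Type*} [Lattice L] (a : L) (V : Finset L) : Prop :=
  ∃ h : V.Nonempty, a ≤ V.sup' h id

/-- A join cover of `a` is nontrivial if no member of it is above `a`. -/
def IsNontrivialJoinCover {L : Type*} [Lattice L] (a : L) (V : Finset L) : Prop :=
  IsJoinCover a V ∧ ∀ v ∈ V, ¬ a ≤ v

/-- `U` refines `V`: every member of `U` is below a member of `V`. -/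
def JoinRefines {L : Type*} [Lattice L] (U V : Finset L) : Prop :=
  ∀ u ∈ U, ∃ v ∈ V, u ≤ v

/-- The sets `D_k(L)`; `D_0(L)` is the set of join prime elements. -/
def DSet (L : Type*) [Lattice L] : ℕ → Set L
  | 0 => {a | ∀ V : Finset L, ¬ IsNontrivialJoinCover a V}
  | k + 1 => {a | ∀ V : Finset L, IsNontrivialJoinCover a V →
      ∃ U : Finset L, (∀ u ∈ U, u ∈ DSet L k) ∧ JoinRefines U V ∧ IsJoinCover a U}

theorem DSet_subset_succ (L : Type*) [Lattice L] (k : ℕ) : DSet L k ⊆ DSet L (k + 1) := by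
  induction k with
  | zero => exact fun a ha V hV => absurd hV (ha V)
  | succ k ih =>
    intro a ha V hV
    obtain ⟨U, hU, h⟩ := ha V hV
    exact ⟨U, fun u hu => ih (hU u hu), h⟩

/-- `a` is not a proper join. -/
def IsJoinIrreducible {L : Type*} [Lattice L] (a : L) : Prop :=
  ¬ ∃ b c : L, b < a ∧ c < a ∧ a = b ⊔ c

/-- `L` has `D`-rank at most `k`: every join irreducible element is in `D_k(L)`. -/
def DRankLE (L : Type*) [Lattice L] (k : ℕ) : Prop :=
  ∀ a : L, IsJoinIrreducible a → a ∈ DSet L k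

/-- `L` is generated, as a lattice, by a finite set. -/
def IsFinitelyGeneratedLattice (L : Type*) [Lattice L] : Prop :=
  ∃ s : Finset L, ∀ S : Sublattice L, (s : Set L) ⊆ S → S = ⊤

/-- A lattice homomorphism is lower bounded if each set `{u | a ≤ f u}` is empty or has a least
element. -/
def IsLowerBoundedHom {K L : Type*} [Lattice K] [Lattice L] (f : LatticeHom K L) : Prop :=
  ∀ a : L, {u | a ≤ f u} = ∅ ∨ ∃ m, IsLeast {u | a ≤ f u} m

/-- Every homomorphism from a finitely generated lattice to `L` is lower bounded. (A finitely
generated lattice is countable, so that it is enough to let `K` range over `Type`.) -/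
def IsLowerBoundedLattice (L : Type*) [Lattice L] : Prop :=
  ∀ (K : Type) [Lattice K], IsFinitelyGeneratedLattice K →
    ∀ f : LatticeHom K L, IsLowerBoundedHom f

/-- The variety `V_k`: all finitely generated sublattices are lower and upper bounded, of `D`-rank
and dual `D`-rank at most `k`. -/
def InBoundedVariety (k : ℕ) (L : Type*) [Lattice L] : Prop :=
  ∀ S : Sublattice L, IsFinitelyGeneratedLattice S →
    (IsLowerBoundedLattice S ∧ DRankLE S k) ∧ (IsLowerBoundedLattice Sᵒᵈ ∧ DRankLE Sᵒᵈ k)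

theorem InBoundedVariety.mono {k l : ℕ} (h : k ≤ l) {L : Type*} [Lattice L]
    (hL : InBoundedVariety k L) : InBoundedVariety l L := fun S hS =>
  have D (M : Type _) [Lattice M] : DSet M k ⊆ DSet M l :=
    monotone_nat_of_le_succ (DSet_subset_succ M) h
  ⟨⟨(hL S hS).1.1, fun a ha => D _ ((hL S hS).1.2 a ha)⟩,
    ⟨(hL S hS).2.1, fun a ha => D _ ((hL S hS).2.2 a ha)⟩⟩

/-! ### The profinite-bounded completion -/

/-- The congruence of `F_n` that identifies two elements if they have the same image under every
homomorphism to a member of `V_k`. (The image of such a homomorphism is a countable member of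
`V_k`, so that it is enough to let `L` range over `Type`.) -/
def boundedCon (n k : ℕ) : LatticeCon (FreeLattice (Fin n)) where
  r s t := ∀ (L : Type) [Lattice L], InBoundedVariety k L →
    ∀ f : LatticeHom (FreeLattice (Fin n)) L, f s = f t
  iseqv := ⟨fun _ _ _ _ _ => rfl, fun h L _ hL f => (h L hL f).symm,
    fun h₁ h₂ L _ hL f => (h₁ L hL f).trans (h₂ L hL f)⟩
  inf h₁ h₂ L _ hL f := by rw [map_inf, map_inf, h₁ L hL f, h₂ L hL f]
  sup h₁ h₂ L _ hL f := by rw [map_sup, map_sup, h₁ L hL f, h₂ L hL f]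

/-- `B_(n,k)`, the free lattice of rank `n` in the variety `V_k`. -/
def BoundedFree (n k : ℕ) : Type := Quotient (boundedCon n k).toSetoid

namespace BoundedFree

instance (n k : ℕ) : Lattice (BoundedFree n k) :=
  letI : Max (BoundedFree n k) :=
    ⟨Quotient.map₂ (· ⊔ ·) fun _ _ h₁ _ _ h₂ => (boundedCon n k).sup h₁ h₂⟩
  letI : Min (BoundedFree n k) :=
    ⟨Quotient.map₂ (· ⊓ ·) fun _ _ h₁ _ _ h₂ => (boundedCon n k).inf h₁ h₂⟩
  Lattice.mk'
    (by rintro ⟨a⟩ ⟨b⟩; exact congrArg (Quotient.mk _) (sup_comm a b))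
    (by rintro ⟨a⟩ ⟨b⟩ ⟨c⟩; exact congrArg (Quotient.mk _) (sup_assoc a b c))
    (by rintro ⟨a⟩ ⟨b⟩; exact congrArg (Quotient.mk _) (inf_comm a b))
    (by rintro ⟨a⟩ ⟨b⟩ ⟨c⟩; exact congrArg (Quotient.mk _) (inf_assoc a b c))
    (by rintro ⟨a⟩ ⟨b⟩; exact congrArg (Quotient.mk _) (sup_inf_self (a := a) (b := b)))
    (by rintro ⟨a⟩ ⟨b⟩; exact congrArg (Quotient.mk _) (inf_sup_self (a := a) (b := b)))

/-- The canonical homomorphism of `F_n` onto `B_(n,k)`. -/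
def proj (n k : ℕ) : LatticeHom (FreeLattice (Fin n)) (BoundedFree n k) where
  toFun := Quotient.mk _
  map_sup' _ _ := rfl
  map_inf' _ _ := rfl

/-- The canonical homomorphism of `B_(n,l)` onto `B_(n,k)`, for `k ≤ l`. -/
def transition (n : ℕ) {k l : ℕ} (h : k ≤ l) : LatticeHom (BoundedFree n l) (BoundedFree n k) where
  toFun := Quotient.map id fun _ _ hst L _ hL f => hst L (hL.mono h) f
  map_sup' := by rintro ⟨a⟩ ⟨b⟩; rfl
  map_inf' := by rintro ⟨a⟩ ⟨b⟩; rfl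

theorem transition_proj (n : ℕ) {k l : ℕ} (h : k ≤ l) (u : FreeLattice (Fin n)) :
    transition n h (proj n l u) = proj n k u := rfl

end BoundedFree

/-- `H_n`, the inverse limit of the lattices `B_(n,k)`, as a sublattice of their product. -/
def profiniteBoundedCompletion (n : ℕ) : Sublattice (∀ k : ℕ, BoundedFree n k) where
  carrier := {c | ∀ (k l : ℕ) (h : k ≤ l), BoundedFree.transition n h (c l) = c k}
  supClosed' := fun a ha b hb k l h => by
    rw [Pi.sup_apply, Pi.sup_apply, map_sup, ha k l h, hb k l h]
  infClosed' := fun a ha b hb k l h => by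
    rw [Pi.inf_apply, Pi.inf_apply, map_inf, ha k l h, hb k l h]

/-! ### The first-order language of lattices -/

/-- The function symbols of the language of lattices: binary join and meet. -/
inductive LatticeFunc : ℕ → Type
  | sup : LatticeFunc 2
  | inf : LatticeFunc 2

/-- The first-order language of lattices, without constants and relation symbols. -/
def latticeLanguage : FirstOrder.Language where
  Functions := LatticeFunc
  Relations := fun _ => Empty

/-- A lattice as a structure for the language of lattices. -/
instance latticeStructure (L : Type*) [Lattice L] : latticeLanguage.Structure L where
  funMap {_} f := match f with
    | .sup => fun v => v 0 ⊔ v 1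
    | .inf => fun v => v 0 ⊓ v 1
  RelMap r := nomatch r

/-! ### Two sequences -/

/-- The pairs `(y_k, z_k)` with `y_0 = y`, `z_0 = z`, `y_{k+1} = y ⊔ (x ⊓ z_k)` and
`z_{k+1} = z ⊔ (x ⊓ y_k)`. -/
def zigzag {L : Type*} [Lattice L] (x y z : L) : ℕ → L × L
  | 0 => (y, z)
  | k + 1 => (y ⊔ x ⊓ (zigzag x y z k).2, z ⊔ x ⊓ (zigzag x y z k).1)

/-! ### Homomorphisms on free lattices -/

namespace FreeLattice

/-! Two tools carry the proof. The first is Day's doubling of an interval. A failure s ∧ t ≤ u ∨ v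
of (W) disappears when [s ∧ t, u ∨ v] is doubled, while a homomorphism from a free lattice always
lifts to the doubled lattice; hence F_n satisfies (W). Doubling also keeps finite lattices lower and
upper bounded, so finite bounded lattices separate the elements of F_n
(`FreeLattice.exists_isFiniteBounded_not_le`).

The second is the link between least preimages and the sets D_k. By (W), join covers of a term
refine to covers by subterms, so a least preimage given by a term of size m is mapped into D_m
(`FreeLattice.map_mk_mem_DSet`). Conversely, the least preimages of elements of D_k lie in a finite
set that depends only on the source lattice and k (`exists_finite_infClosed_DSet`). This uniformity
makes B_(n,k) finite and gives its projection least and greatest preimages.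

Join semidistributivity follows by descent along D_k, for elements and for ideals
(`mem_ideal_of_mem_DSet`). It holds in Id(F_n), and with its dual in B_(n,k), hence componentwise in
H_n. A failure of (W) in H_n would show at a finite level, where doubling B_(n,k) gives another
finite bounded lattice and so a contradiction. The least and greatest preimages of the components of
a point of H_n lie below and above it and determine it; this yields the isomorphism with DM(F_n).

In Id(F_n), the unions Y and Z of the zigzag sequences have the same meet with X, but (W) keeps x ∧
(y ∨ z) out of both. So meet semidistributivity, a first-order sentence, separates Id(F_n) from
DM(F_n). -/

theorem induction_on {α : Type*} {p : FreeLattice α → Prop} (w : FreeLattice α)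
    (of : ∀ a, p (of a)) (sup : ∀ u v, p u → p v → p (u ⊔ v))
    (inf : ∀ u v, p u → p v → p (u ⊓ v)) : p w := by
  obtain ⟨t⟩ := w
  change p (mk t)
  induction t with
  | var a => exact of a
  | sup s t hs ht => exact sup _ _ hs ht
  | inf s t hs ht => exact inf _ _ hs ht

/-- The homomorphism that extends a map of the generators. -/
noncomputable def lift {α L : Type*} [Lattice L] (g : α → L) : LatticeHom (FreeLattice α) L :=
  (existsUnique_lift g).choose

@[simp]
theorem lift_of {α L : Type*} [Lattice L] (g : α → L) (a : α) : lift g (of a) = g a :=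
  (existsUnique_lift g).choose_spec.1 a

theorem hom_ext {α L : Type*} [Lattice L] {f g : LatticeHom (FreeLattice α) L}
    (h : ∀ a, f (of a) = g (of a)) : f = g :=
  (existsUnique_lift fun a => g (of a)).unique h fun _ => rfl

theorem isFinitelyGenerated (α : Type*) [Finite α] :
    IsFinitelyGeneratedLattice (FreeLattice α) := by
  refine ⟨(Set.finite_range (of (α := α))).toFinset, fun S hS => ?_⟩
  rw [Set.Finite.coe_toFinset] at hS
  refine eq_top_iff.2 fun w _ => ?_
  induction w using induction_on with
  | of a => exact hS ⟨a, rfl⟩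
  | sup u v hu hv => exact S.sup_mem (hu trivial) (hv trivial)
  | inf u v hu hv => exact S.inf_mem (hu trivial) (hv trivial)

/-- The map to the two-element lattice `Prop` that sends a to true and the other generators to false
detects the filter above a. Generators are join prime because true is join prime in `Prop`. -/
theorem of_le_iff {α : Type*} (a : α) (w : FreeLattice α) :
    of a ≤ w ↔ lift (fun b => b = a) w := by
  constructor
  · intro h
    have : lift (fun b => b = a) (of a) ≤ lift (fun b => b = a) w := OrderHomClass.mono _ h
    rw [lift_of] at this
    exact this rfl
  · induction w using induction_on with
    | of b => rw [lift_of]; rintro rfl; exact le_rfl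
    | sup u v hu hv =>
      rw [map_sup]
      exact fun h => h.elim (fun h => le_sup_of_le_left (hu h)) fun h => le_sup_of_le_right (hv h)
    | inf u v hu hv =>
      rw [map_inf]
      exact fun h => le_inf (hu h.1) (hv h.2)

theorem le_of_iff {α : Type*} (a : α) (w : FreeLattice α) :
    w ≤ of a ↔ ¬ lift (fun b => b ≠ a) w := by
  constructor
  · intro h h'
    have : lift (fun b => b ≠ a) w ≤ lift (fun b => b ≠ a) (of a) := OrderHomClass.mono _ h
    rw [lift_of] at this
    exact this h' rfl
  · induction w using induction_on with
    | of b =>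
      rw [lift_of]
      intro h
      rw [not_not.1 h]
    | sup u v hu hv =>
      rw [map_sup]
      exact fun h => sup_le (hu fun h' => h (Or.inl h')) (hv fun h' => h (Or.inr h'))
    | inf u v hu hv =>
      rw [map_inf]
      intro h
      by_cases h' : lift (fun b => b ≠ a) u
      · exact inf_le_of_right_le (hv fun h'' => h ⟨h', h''⟩)
      · exact inf_le_of_left_le (hu h')

theorem of_le_sup_iff {α : Type*} {a : α} {u v : FreeLattice α} :
    of a ≤ u ⊔ v ↔ of a ≤ u ∨ of a ≤ v := by
  rw [of_le_iff, map_sup, of_le_iff, of_le_iff]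
  rfl

/-- The dual automorphism that fixes the generators. -/
noncomputable def dualHom (α : Type*) : LatticeHom (FreeLattice α) (FreeLattice α)ᵒᵈ :=
  lift fun a => OrderDual.toDual (of a)

/-- The involution that interchanges joins and meets and fixes the generators. -/
noncomputable def flip {α : Type*} (w : FreeLattice α) : FreeLattice α :=
  OrderDual.ofDual (dualHom α w)

theorem flip_of {α : Type*} (a : α) : flip (of a) = of a :=
  congrArg OrderDual.ofDual (lift_of _ a)

theorem flip_sup {α : Type*} (u v : FreeLattice α) : flip (u ⊔ v) = flip u ⊓ flip v :=
  congrArg OrderDual.ofDual (map_sup (dualHom α) u v)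

theorem flip_inf {α : Type*} (u v : FreeLattice α) : flip (u ⊓ v) = flip u ⊔ flip v :=
  congrArg OrderDual.ofDual (map_inf (dualHom α) u v)

@[simp]
theorem flip_flip {α : Type*} (w : FreeLattice α) : flip (flip w) = w := by
  induction w using induction_on with
  | of a => rw [flip_of, flip_of]
  | sup u v hu hv => rw [flip_sup, flip_inf, hu, hv]
  | inf u v hu hv => rw [flip_inf, flip_sup, hu, hv]

theorem flip_le_flip {α : Type*} {u v : FreeLattice α} (h : u ≤ v) : flip v ≤ flip u :=
  OrderHomClass.mono (dualHom α) h

theorem le_flip_iff {α : Type*} {u v : FreeLattice α} : u ≤ flip v ↔ v ≤ flip u :=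
  ⟨fun h => by simpa using flip_le_flip h, fun h => by simpa using flip_le_flip h⟩

end FreeLattice

/-! ### Doubling an interval -/

/-- The lattice obtained from `A` by doubling the interval `[p, q]`. The second component of an
element tells whether it is above the upper copy of `p`. -/
def DoubledInterval {A : Type*} [Lattice A] (p q : A) : Type _ :=
  {z : A × Prop // (z.2 → p ≤ z.1) ∧ (p ≤ z.1 → ¬ z.2 → z.1 ≤ q)}

namespace DoubledInterval

variable {A : Type*} [Lattice A] {p q : A}

instance : PartialOrder (DoubledInterval p q) :=
  inferInstanceAs (PartialOrder {z : A × Prop // (z.2 → p ≤ z.1) ∧ (p ≤ z.1 → ¬ z.2 → z.1 ≤ q)})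

instance [Finite A] : Finite (DoubledInterval p q) :=
  inferInstanceAs (Finite {z : A × Prop // (z.2 → p ≤ z.1) ∧ (p ≤ z.1 → ¬ z.2 → z.1 ≤ q)})

theorem le_iff {z w : DoubledInterval p q} : z ≤ w ↔ z.1.1 ≤ w.1.1 ∧ (z.1.2 → w.1.2) := Iff.rfl

instance : Lattice (DoubledInterval p q) where
  sup z w := ⟨(z.1.1 ⊔ w.1.1,
      z.1.2 ∨ w.1.2 ∨ (p ≤ z.1.1 ⊔ w.1.1 ∧ ¬ z.1.1 ⊔ w.1.1 ≤ q)), by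
    refine ⟨?_, fun h h' => by_contra fun h'' => h' (Or.inr (Or.inr ⟨h, h''⟩))⟩
    rintro (h | h | h)
    · exact le_sup_of_le_left (z.2.1 h)
    · exact le_sup_of_le_right (w.2.1 h)
    · exact h.1⟩
  le_sup_left z w := le_iff.2 ⟨le_sup_left, Or.inl⟩
  le_sup_right z w := le_iff.2 ⟨le_sup_right, fun h => Or.inr (Or.inl h)⟩
  sup_le z w x h₁ h₂ := by
    refine le_iff.2 ⟨sup_le h₁.1 h₂.1, ?_⟩
    rintro (h | h | h)
    · exact h₁.2 h
    · exact h₂.2 h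
    · have hle : z.1.1 ⊔ w.1.1 ≤ x.1.1 := sup_le h₁.1 h₂.1
      exact by_contra fun h' => h.2 (hle.trans (x.2.2 (h.1.trans hle) h'))
  inf z w := ⟨(z.1.1 ⊓ w.1.1, z.1.2 ∧ w.1.2), by
    refine ⟨fun h => le_inf (z.2.1 h.1) (w.2.1 h.2), fun h h' => ?_⟩
    by_cases hz : z.1.2
    · exact inf_le_of_right_le (w.2.2 (h.trans inf_le_right) fun hw => h' ⟨hz, hw⟩)
    · exact inf_le_of_left_le (z.2.2 (h.trans inf_le_left) hz)⟩
  inf_le_left z w := le_iff.2 ⟨inf_le_left, And.left⟩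
  inf_le_right z w := le_iff.2 ⟨inf_le_right, And.right⟩
  le_inf z w x h₁ h₂ := le_iff.2 ⟨le_inf h₁.1 h₂.1, fun h => ⟨h₁.2 h, h₂.2 h⟩⟩

/-- The homomorphism that identifies the two copies of the interval. -/
def fstHom (p q : A) : LatticeHom (DoubledInterval p q) A where
  toFun z := z.1.1
  map_sup' _ _ := rfl
  map_inf' _ _ := rfl

/-- The copy of an element of `A`, the lower one in the interval. -/
def lower (p q a : A) : DoubledInterval p q :=
  ⟨(a, p ≤ a ∧ ¬ a ≤ q), And.left, fun h h' => by_contra fun h'' => h' ⟨h, h''⟩⟩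

/-- Doubling a failure of Whitman's condition removes it. -/
theorem not_inf_le_sup {s t u v : DoubledInterval p q}
    (hp : p ≤ s.1.1 ⊓ t.1.1) (hq : u.1.1 ⊔ v.1.1 ≤ q) (hs : ¬ s.1.1 ≤ q) (ht : ¬ t.1.1 ≤ q)
    (hu : ¬ p ≤ u.1.1) (hv : ¬ p ≤ v.1.1) : ¬ s ⊓ t ≤ u ⊔ v := by
  intro h
  have hs' : s.1.2 := by_contra fun h => hs (s.2.2 (hp.trans inf_le_left) h)
  have ht' : t.1.2 := by_contra fun h => ht (t.2.2 (hp.trans inf_le_right) h)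
  rcases h.2 ⟨hs', ht'⟩ with h | h | h
  · exact hu (u.2.1 h)
  · exact hv (v.2.1 h)
  · exact h.2 hq

end DoubledInterval

/-- A homomorphism from a free lattice lifts to the lattice with a doubled interval. -/
theorem FreeLattice.exists_lift_doubledInterval {α A : Type*} [Lattice A] (p q : A)
    (f : LatticeHom (FreeLattice α) A) :
    ∃ g : LatticeHom (FreeLattice α) (DoubledInterval p q), ∀ w, (g w).1.1 = f w := by
  refine ⟨lift fun a => .lower p q (f (of a)), fun w => ?_⟩
  have : (DoubledInterval.fstHom p q).comp (lift fun a => .lower p q (f (of a))) = f :=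
    hom_ext fun a => by
      rw [LatticeHom.comp_apply, lift_of]
      rfl
  exact DFunLike.congr_fun this w

theorem FreeLattice.whitmanCondition (α : Type*) : WhitmanCondition (FreeLattice α) := by
  intro s t u v h
  by_contra! hn
  -- The interval is doubled in the free lattice itself and the identity is lifted: the lift
  -- preserves the inequality that doubling destroys.
  obtain ⟨g, hg⟩ := exists_lift_doubledInterval (s ⊓ t) (u ⊔ v) (LatticeHom.id (FreeLattice α))
  simp only [LatticeHom.id_apply] at hg
  refine DoubledInterval.not_inf_le_sup (s := g s) (t := g t) (u := g u) (v := g v)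
    ?_ ?_ ?_ ?_ ?_ ?_ ?_
  · rw [hg, hg]
  · rw [hg, hg]
  · rw [hg]; exact hn.1
  · rw [hg]; exact hn.2.1
  · rw [hg]; exact hn.2.2.1
  · rw [hg]; exact hn.2.2.2
  · rw [← map_inf, ← map_sup]
    exact OrderHomClass.mono g h

/-! ### Join covers in free lattices -/

theorem isJoinCover_iff {L : Type*} [Lattice L] {a : L} {V : Finset L} :
    IsJoinCover a V ↔ V.Nonempty ∧ ∀ b, (∀ v ∈ V, v ≤ b) → a ≤ b :=
  ⟨fun ⟨h, ha⟩ => ⟨h, fun _ hb => ha.trans (Finset.sup'_le h _ hb)⟩,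
    fun ⟨h, ha⟩ => ⟨h, ha _ fun _ hv => Finset.le_sup' id hv⟩⟩

theorem JoinRefines.trans {L : Type*} [Lattice L] {U V W : Finset L} (h₁ : JoinRefines U V)
    (h₂ : JoinRefines V W) : JoinRefines U W := fun u hu =>
  let ⟨v, hv, huv⟩ := h₁ u hu
  let ⟨w, hw, hvw⟩ := h₂ v hv
  ⟨w, hw, huv.trans hvw⟩

theorem IsJoinCover.of_joinRefines {L : Type*} [Lattice L] {a : L} {U V : Finset L}
    (hV : IsJoinCover a V) (h : JoinRefines V U) : IsJoinCover a U := by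
  rw [isJoinCover_iff] at hV ⊢
  refine ⟨?_, fun b hb => hV.2 b fun v hv => ?_⟩
  · obtain ⟨v, hv⟩ := hV.1
    obtain ⟨u, hu, -⟩ := h v hv
    exact ⟨u, hu⟩
  · obtain ⟨u, hu, hvu⟩ := h v hv
    exact hvu.trans (hb u hu)

theorem WhitmanCondition.inf_le_sup' {L : Type*} [Lattice L] (hL : WhitmanCondition L) {s t : L}
    {W : Finset L} (hW : W.Nonempty) :
    s ⊓ t ≤ W.sup' hW id → s ≤ W.sup' hW id ∨ t ≤ W.sup' hW id ∨ ∃ w ∈ W, s ⊓ t ≤ w := by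
  induction hW using Finset.Nonempty.cons_induction with
  | singleton a => simpa using fun h => Or.inr (Or.inr h)
  | cons a W ha hW ih =>
    rw [Finset.sup'_cons hW]
    intro h
    rcases hL _ _ _ _ h with h | h | h | h
    · exact Or.inl h
    · exact Or.inr (Or.inl h)
    · exact Or.inr (Or.inr ⟨a, Finset.mem_cons_self .., h⟩)
    · rcases ih h with h | h | ⟨w, hw, h⟩
      · exact Or.inl (le_sup_of_le_right h)
      · exact Or.inr (Or.inl (le_sup_of_le_right h))
      · exact Or.inr (Or.inr ⟨w, Finset.mem_cons_of_mem hw, h⟩)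

theorem FreeLattice.of_le_sup' {α : Type*} {a : α} {W : Finset (FreeLattice α)}
    (hW : W.Nonempty) : of a ≤ W.sup' hW id → ∃ w ∈ W, of a ≤ w := by
  induction hW using Finset.Nonempty.cons_induction with
  | singleton b => simp
  | cons b W hb hW ih =>
    rw [Finset.sup'_cons hW, of_le_sup_iff]
    rintro (h | h)
    · exact ⟨b, Finset.mem_cons_self .., h⟩
    · obtain ⟨w, hw, h⟩ := ih h
      exact ⟨w, Finset.mem_cons_of_mem hw, h⟩

namespace LatticeTerm

/-- The number of symbols of a term. -/
def size {α : Type*} : LatticeTerm α → ℕ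
  | var _ => 1
  | sup s t => size s + size t + 1
  | inf s t => size s + size t + 1

theorem size_pos {α : Type*} (t : LatticeTerm α) : 0 < t.size := by
  cases t <;> simp [size]

open Classical in
/-- The values of the subterms of a term in the free lattice. -/
noncomputable def subterms {α : Type*} : LatticeTerm α → Finset (FreeLattice α)
  | var a => {FreeLattice.of a}
  | sup s t => insert (FreeLattice.mk (sup s t)) (subterms s ∪ subterms t)
  | inf s t => insert (FreeLattice.mk (inf s t)) (subterms s ∪ subterms t)

theorem mem_subterms_self {α : Type*} (t : LatticeTerm α) : FreeLattice.mk t ∈ t.subterms := by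
  classical
  cases t
  · exact Finset.mem_singleton_self _
  · exact Finset.mem_insert_self ..
  · exact Finset.mem_insert_self ..

theorem eq_or_size_lt_of_mem_subterms {α : Type*} {t : LatticeTerm α} {u : FreeLattice α}
    (hu : u ∈ t.subterms) :
    u = FreeLattice.mk t ∨ ∃ s : LatticeTerm α, s.size < t.size ∧ FreeLattice.mk s = u := by
  classical
  induction t with
  | var a => exact Or.inl (Finset.mem_singleton.1 hu)
  | sup s t hs ht | inf s t hs ht =>
    rw [subterms, Finset.mem_insert, Finset.mem_union] at hu
    rcases hu with hu | hu | hu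
    · exact Or.inl hu
    · right
      rcases hs hu with rfl | ⟨r, hr, rfl⟩
      · exact ⟨s, by rw [size]; omega, rfl⟩
      · exact ⟨r, by rw [size]; omega, rfl⟩
    · right
      rcases ht hu with rfl | ⟨r, hr, rfl⟩
      · exact ⟨t, by rw [size]; omega, rfl⟩
      · exact ⟨r, by rw [size]; omega, rfl⟩

/-- Every join cover of a term refines to a join cover by subterms. -/
theorem exists_refinement_subterms {α : Type*} (t : LatticeTerm α) (W : Finset (FreeLattice α))
    (h : IsJoinCover (FreeLattice.mk t) W) :
    ∃ U ⊆ t.subterms, JoinRefines U W ∧ IsJoinCover (FreeLattice.mk t) U := by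
  classical
  have trivial_case : ∀ t : LatticeTerm α, (∃ w ∈ W, FreeLattice.mk t ≤ w) →
      ∃ U ⊆ t.subterms, JoinRefines U W ∧ IsJoinCover (FreeLattice.mk t) U := by
    rintro t ⟨w, hw, h⟩
    refine ⟨{FreeLattice.mk t}, ?_, ?_, ?_⟩
    · rw [Finset.singleton_subset_iff]
      exact t.mem_subterms_self
    · intro u hu
      rw [Finset.mem_singleton.1 hu]
      exact ⟨w, hw, h⟩
    · exact ⟨Finset.singleton_nonempty _, by simp⟩
  induction t with
  | var a => exact trivial_case _ (FreeLattice.of_le_sup' h.1 h.2)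
  | sup s t hs ht =>
    obtain ⟨hne, h⟩ := h
    have hle : FreeLattice.mk s ⊔ FreeLattice.mk t ≤ W.sup' hne id := h
    obtain ⟨U₁, hU₁, hr₁, hc₁⟩ := hs ⟨hne, le_sup_left.trans hle⟩
    obtain ⟨U₂, hU₂, hr₂, hc₂⟩ := ht ⟨hne, le_sup_right.trans hle⟩
    rw [isJoinCover_iff] at hc₁ hc₂
    refine ⟨U₁ ∪ U₂, ?_, ?_, isJoinCover_iff.2 ⟨hc₁.1.mono Finset.subset_union_left, ?_⟩⟩
    · exact (Finset.union_subset_union hU₁ hU₂).trans (Finset.subset_insert ..)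
    · intro u hu
      exact (Finset.mem_union.1 hu).elim (hr₁ u) (hr₂ u)
    · intro b hb
      exact sup_le (a := FreeLattice.mk s) (b := FreeLattice.mk t)
        (hc₁.2 b fun v hv => hb v (Finset.mem_union_left _ hv))
        (hc₂.2 b fun v hv => hb v (Finset.mem_union_right _ hv))
  | inf s t hs ht =>
    obtain ⟨hne, h⟩ := h
    -- By (W), a cover of a meet either covers one of the two meetands or is trivial.
    rcases (FreeLattice.whitmanCondition α).inf_le_sup' (s := FreeLattice.mk s)
      (t := FreeLattice.mk t) hne h with h | h | h
    · obtain ⟨U, hU, hr, hc⟩ := hs ⟨hne, h⟩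
      exact ⟨U, (hU.trans Finset.subset_union_left).trans (Finset.subset_insert ..), hr, hc.1,
        (inf_le_left (a := FreeLattice.mk s) (b := FreeLattice.mk t)).trans hc.2⟩
    · obtain ⟨U, hU, hr, hc⟩ := ht ⟨hne, h⟩
      exact ⟨U, (hU.trans Finset.subset_union_right).trans (Finset.subset_insert ..), hr, hc.1,
        (inf_le_right (a := FreeLattice.mk s) (b := FreeLattice.mk t)).trans hc.2⟩
    · exact trivial_case (inf s t) h

end LatticeTerm

/-! ### Lower bounded images of free lattices -/

theorem IsJoinCover.map {K L : Type*} [Lattice K] [Lattice L] [DecidableEq L]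
    (f : LatticeHom K L) {a : K} {U : Finset K} (h : IsJoinCover a U) :
    IsJoinCover (f a) (U.image f) := by
  refine ⟨h.1.image f, ?_⟩
  rw [Finset.sup'_image]
  exact (OrderHomClass.mono f h.2).trans (map_finset_sup' f h.1 id).le

/-- A least preimage under a lower bounded epimorphism from a free lattice is mapped into
`D_m`, for `m` the size of a term. -/
theorem FreeLattice.map_mk_mem_DSet {α S : Type*} [Lattice S]
    (f : LatticeHom (FreeLattice α) S) (hf : Function.Surjective f)
    (hleast : ∀ w, ∃ m, ∀ u, f w ≤ f u ↔ m ≤ u) (m : ℕ) (t : LatticeTerm α)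
    (ht : t.size ≤ m) (hmin : ∀ u, f (mk t) ≤ f u → mk t ≤ u) : f (mk t) ∈ DSet S m := by
  classical
  choose κ hκ using hleast
  have κ_le (u) : κ u ≤ u := (hκ u u).1 le_rfl
  have le_κ (u) : f u ≤ f (κ u) := (hκ u _).2 le_rfl
  induction m generalizing t with
  | zero => exact absurd t.size_pos (by omega)
  | succ m ih =>
  intro V hV
  obtain ⟨g, hg⟩ := hf.hasRightInverse
  have hW : IsJoinCover (mk t) (V.image g) := by
    obtain ⟨hne, hle⟩ := hV.1
    refine ⟨hne.image g, hmin _ ?_⟩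
    rw [map_finset_sup', Finset.sup'_image]
    refine hle.trans (Finset.sup'_mono_fun fun v _ => ?_)
    exact (hg v).ge
  -- The cardinality of `below U` measures refinement: passing to a finer cover can only shrink this
  -- set, so a cover with the fewest such subterms cannot be refined essentially further.
  let below (U : Finset (FreeLattice α)) : Finset (FreeLattice α) :=
    t.subterms.filter fun s => ∃ u ∈ U, s ≤ u
  let C : Finset (Finset (FreeLattice α)) :=
    t.subterms.powerset.filter fun U => JoinRefines U (V.image g) ∧ IsJoinCover (mk t) U
  have memC (U) : U ∈ C ↔ U ⊆ t.subterms ∧ JoinRefines U (V.image g) ∧ IsJoinCover (mk t) U := by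
    rw [Finset.mem_filter, Finset.mem_powerset]
  have hC : C.Nonempty := by
    obtain ⟨U, hU⟩ := t.exists_refinement_subterms _ hW
    exact ⟨U, (memC U).2 hU⟩
  obtain ⟨U, hUC, hUmin⟩ := C.exists_min_image (fun U => (below U).card) hC
  obtain ⟨hUsub, hUref, hUcov⟩ := (memC U).1 hUC
  have key : ∀ u ∈ U, ∃ v ∈ U, u ≤ κ v := by
    -- Replacing every member of U by its least preimage keeps a cover, since the term is itself
    -- least in its class. Refining this cover to subterms must, by minimality, leave `below U`
    -- unchanged.
    have hcov : IsJoinCover (mk t) (U.image κ) := by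
      obtain ⟨hne, hle⟩ := hUcov
      refine ⟨hne.image κ, hmin _ ((OrderHomClass.mono f hle).trans ?_)⟩
      rw [Finset.sup'_image, map_finset_sup', map_finset_sup']
      exact Finset.sup'_mono_fun fun u _ => le_κ u
    obtain ⟨U', hU'sub, hU'ref, hU'cov⟩ := t.exists_refinement_subterms _ hcov
    have href : JoinRefines U' U := by
      intro u hu
      obtain ⟨v, hv, huv⟩ := hU'ref u hu
      obtain ⟨w, hw, rfl⟩ := Finset.mem_image.1 hv
      exact ⟨w, hw, huv.trans (κ_le w)⟩
    have hsub : below U' ⊆ below U := fun s hs => by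
      obtain ⟨hs, u, hu, hsu⟩ := Finset.mem_filter.1 hs
      obtain ⟨v, hv, huv⟩ := href u hu
      exact Finset.mem_filter.2 ⟨hs, v, hv, hsu.trans huv⟩
    have heq : below U' = below U :=
      Finset.eq_of_subset_of_card_le hsub (hUmin U' ((memC U').2 ⟨hU'sub, href.trans hUref, hU'cov⟩))
    intro u hu
    have : u ∈ below U' := by
      rw [heq]
      exact Finset.mem_filter.2 ⟨hUsub hu, u, hu, le_rfl⟩
    obtain ⟨-, u', hu', huu'⟩ := Finset.mem_filter.1 this
    obtain ⟨v, hv, hle⟩ := hU'ref u' hu'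
    obtain ⟨w, hw, rfl⟩ := Finset.mem_image.1 hv
    exact ⟨w, hw, huu'.trans hle⟩
  refine ⟨(U.filter fun u => κ u = u).image f, ?_, ?_, IsJoinCover.map f ?_⟩
  · intro a ha
    obtain ⟨u, hu, rfl⟩ := Finset.mem_image.1 ha
    obtain ⟨hu, hκu⟩ := Finset.mem_filter.1 hu
    -- If the subterm were the whole term, its image would lie below a single member of V, against
    -- nontriviality. Otherwise the size drops.
    rcases LatticeTerm.eq_or_size_lt_of_mem_subterms (hUsub hu) with rfl | ⟨s, hs, rfl⟩
    · obtain ⟨w, hw, hle⟩ := hUref _ hu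
      obtain ⟨v, hv, rfl⟩ := Finset.mem_image.1 hw
      exact absurd ((OrderHomClass.mono f hle).trans (hg v).le) (hV.2 v hv)
    · exact ih s (by omega) fun u hu => hκu.ge.trans ((hκ _ _).1 hu)
  · intro a ha
    obtain ⟨u, hu, rfl⟩ := Finset.mem_image.1 ha
    obtain ⟨w, hw, hle⟩ := hUref u (Finset.mem_filter.1 hu).1
    obtain ⟨v, hv, rfl⟩ := Finset.mem_image.1 hw
    exact ⟨v, hv, (OrderHomClass.mono f hle).trans (hg v).le⟩
  · refine IsJoinCover.of_joinRefines hUcov fun u hu => ?_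
    -- A maximal v in U satisfies v ≤ κ w ≤ w for some w in U, so w = v and v is a least preimage.
    -- Hence the fixed points of κ in U still cover.
    obtain ⟨v, huv, hv⟩ := U.exists_le_maximal hu
    obtain ⟨w, hw, hvw⟩ := key v hv.1
    obtain rfl : w = v := le_antisymm (hv.2 hw (hvw.trans (κ_le w))) (hvw.trans (κ_le w))
    exact ⟨w, Finset.mem_filter.2 ⟨hw, le_antisymm (κ_le w) hvw⟩, huv⟩

theorem FreeLattice.exists_mem_DSet {α S : Type*} [Lattice S]
    (f : LatticeHom (FreeLattice α) S) (hf : Function.Surjective f)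
    (hleast : ∀ w, ∃ m, ∀ u, f w ≤ f u ↔ m ≤ u) (a : S) : ∃ m, a ∈ DSet S m := by
  obtain ⟨w, rfl⟩ := hf a
  obtain ⟨⟨t⟩, ht⟩ := hleast w
  change ∀ u, f w ≤ f u ↔ mk t ≤ u at ht
  have heq : f w = f (mk t) :=
    le_antisymm ((ht _).2 le_rfl) (OrderHomClass.mono f ((ht w).1 le_rfl))
  rw [heq] at ht ⊢
  exact ⟨t.size, map_mk_mem_DSet f hf hleast _ t le_rfl fun u => (ht u).1⟩

/-! ### Lower bounded lattices and the sets `D_k` -/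

theorem DSet_mono (L : Type*) [Lattice L] : Monotone (DSet L) :=
  monotone_nat_of_le_succ (DSet_subset_succ L)

theorem IsFinitelyGeneratedLattice.of_surjective {K L : Type*} [Lattice K] [Lattice L]
    (hK : IsFinitelyGeneratedLattice K) (f : LatticeHom K L) (hf : Function.Surjective f) :
    IsFinitelyGeneratedLattice L := by
  classical
  obtain ⟨Y, hY⟩ := hK
  refine ⟨Y.image f, fun S hS => eq_top_iff.2 fun a _ => ?_⟩
  obtain ⟨u, rfl⟩ := hf a
  have : S.comap f = ⊤ := hY _ fun y hy => hS (Finset.mem_coe.2 (Finset.mem_image_of_mem f hy))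
  have hu : u ∈ S.comap f := this ▸ Sublattice.mem_top u
  exact hu

/-- The elements u with the required property form a sublattice containing the generators. Meets are
handled by the closure of M; a join needs an argument only when neither joinand is already mapped
above a. -/
theorem exists_mem_le_of_generates {K L : Type*} [Lattice K] [Lattice L] {Y : Finset K}
    (hY : ∀ S : Sublattice K, (Y : Set K) ⊆ S → S = ⊤) {M : Set K} (hYM : (Y : Set K) ⊆ M)
    (hM : InfClosed M) (f : LatticeHom K L) (a : L)
    (hsup : ∀ u v, ¬ a ≤ f u → ¬ a ≤ f v → a ≤ f (u ⊔ v) → ∃ w ∈ M, w ≤ u ⊔ v ∧ a ≤ f w)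
    (u : K) (hu : a ≤ f u) : ∃ w ∈ M, w ≤ u ∧ a ≤ f w := by
  let S : Sublattice K :=
    { carrier := {u | a ≤ f u → ∃ w ∈ M, w ≤ u ∧ a ≤ f w}
      supClosed' := fun u hu v hv h => by
        by_cases h₁ : a ≤ f u
        · obtain ⟨w, hw, hwu, haw⟩ := hu h₁
          exact ⟨w, hw, le_sup_of_le_left hwu, haw⟩
        by_cases h₂ : a ≤ f v
        · obtain ⟨w, hw, hwv, haw⟩ := hv h₂
          exact ⟨w, hw, le_sup_of_le_right hwv, haw⟩
        exact hsup u v h₁ h₂ h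
      infClosed' := fun u hu v hv h => by
        rw [map_inf] at h
        obtain ⟨w, hw, hwu, haw⟩ := hu (h.trans inf_le_left)
        obtain ⟨w', hw', hwv', haw'⟩ := hv (h.trans inf_le_right)
        refine ⟨w ⊓ w', hM hw hw', inf_le_inf hwu hwv', ?_⟩
        rw [map_inf]
        exact le_inf haw haw' }
  have : S = ⊤ := hY S fun y hy h => ⟨y, hYM hy, le_rfl, h⟩
  have hmem : u ∈ S := this ▸ Sublattice.mem_top u
  exact hmem hu

/-- In a finitely generated lattice there are, for every `k`, finitely many elements that contain
the least preimages of all elements of `D_k`, for all homomorphisms. -/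
theorem exists_finite_infClosed_DSet (K : Type*) [Lattice K] (hK : IsFinitelyGeneratedLattice K)
    (k : ℕ) : ∃ M : Set K, M.Finite ∧ InfClosed M ∧ ∀ (L : Type) [Lattice L]
      (f : LatticeHom K L), ∀ a ∈ DSet L k, ∀ u, a ≤ f u → ∃ v ∈ M, v ≤ u ∧ a ≤ f v := by
  classical
  obtain ⟨Y, hY⟩ := hK
  have cover_pair {L : Type} [Lattice L] (f : LatticeHom K L) (a : L) (u v : K)
      (hu : ¬ a ≤ f u) (hv : ¬ a ≤ f v) (h : a ≤ f (u ⊔ v)) :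
      IsNontrivialJoinCover a {f u, f v} := by
    refine ⟨isJoinCover_iff.2 ⟨⟨f u, by simp⟩, fun b hb => h.trans ?_⟩, ?_⟩
    · rw [map_sup]
      exact sup_le (hb _ (by simp)) (hb _ (by simp))
    · simp [hu, hv]
  induction k with
  | zero =>
    refine ⟨infClosure Y, Y.finite_toSet.infClosure, infClosed_infClosure, ?_⟩
    intro L _ f a ha
    exact exists_mem_le_of_generates hY subset_infClosure infClosed_infClosure f a
      fun u v hu hv h => absurd (cover_pair f a u v hu hv h) (ha _)
  | succ k ih =>
    obtain ⟨M, hM, -, ih⟩ := ih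
    -- A refinement in D_k of a cover of a is lifted member by member to M, and the join of the
    -- lifts is the new witness; this calls for the joins of M. The closure under meets serves the
    -- meet step.
    refine ⟨infClosure (Y ∪ supClosure M), (Y.finite_toSet.union hM.supClosure).infClosure,
      infClosed_infClosure, ?_⟩
    intro L _ f a ha
    refine exists_mem_le_of_generates hY (Set.subset_union_left.trans subset_infClosure)
      infClosed_infClosure f a fun u v hu hv h => ?_
    obtain ⟨U, hU, href, hne, hcov⟩ := ha _ (cover_pair f a u v hu hv h)
    have hex : ∀ c ∈ U, ∃ w ∈ M, w ≤ u ⊔ v ∧ c ≤ f w := by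
      intro c hc
      obtain ⟨d, hd, hcd⟩ := href c hc
      rw [Finset.mem_insert, Finset.mem_singleton] at hd
      rcases hd with rfl | rfl
      · obtain ⟨w, hw, hwu, hcw⟩ := ih L f c (hU c hc) u hcd
        exact ⟨w, hw, le_sup_of_le_left hwu, hcw⟩
      · obtain ⟨w, hw, hwv, hcw⟩ := ih L f c (hU c hc) v hcd
        exact ⟨w, hw, le_sup_of_le_right hwv, hcw⟩
    have : Nonempty K := ⟨u⟩
    choose! g hgM hg hgf using hex
    refine ⟨U.sup' hne g, subset_infClosure (Or.inr ?_), Finset.sup'_le _ _ hg, hcov.trans ?_⟩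
    · exact supClosed_supClosure.finsetSup'_mem hne fun c hc => subset_supClosure (hgM c hc)
    · rw [map_finset_sup']
      exact Finset.sup'_mono_fun hgf

theorem eq_empty_or_exists_isLeast {K L : Type*} [Lattice K] [Lattice L] (f : LatticeHom K L)
    (a : L) {M : Set K} (hM : M.Finite) (h : ∀ u, a ≤ f u → ∃ v ∈ M, v ≤ u ∧ a ≤ f v) :
    {u | a ≤ f u} = ∅ ∨ ∃ m, IsLeast {u | a ≤ f u} m := by
  refine (Set.eq_empty_or_nonempty _).imp_right fun ⟨u, hu⟩ => ?_
  have hfin : {v ∈ M | a ≤ f v}.Finite := hM.subset (Set.sep_subset ..)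
  have hne : hfin.toFinset.Nonempty := by
    obtain ⟨v, hv, -, hav⟩ := h u hu
    exact ⟨v, hfin.mem_toFinset.2 ⟨hv, hav⟩⟩
  refine ⟨hfin.toFinset.inf' hne id, ?_, fun u hu => ?_⟩
  · rw [Set.mem_ofPred_eq, map_finset_inf']
    exact Finset.le_inf' _ _ fun v hv => (hfin.mem_toFinset.1 hv).2
  · obtain ⟨v, hv, hvu, hav⟩ := h u hu
    exact (Finset.inf'_le id (hfin.mem_toFinset.2 ⟨hv, hav⟩)).trans hvu

theorem isLowerBoundedLattice_of_DSet (L : Type) [Lattice L] (h : ∀ a : L, ∃ k, a ∈ DSet L k) :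
    IsLowerBoundedLattice L := by
  intro K _ hK f a
  obtain ⟨k, hk⟩ := h a
  obtain ⟨M, hM, -, hMk⟩ := exists_finite_infClosed_DSet K hK k
  exact eq_empty_or_exists_isLeast f a hM (hMk L f a hk)

/-- A proper join b ∨ c has the nontrivial cover {b, c}, and a refinement of it that still covers
has join exactly b ∨ c. The descent on m stops at join irreducible elements, which the rank bound
places in D_k, or at D_0. -/
theorem mem_supClosure_DSet {S : Type*} [Lattice S] {k : ℕ} (hS : DRankLE S k) (m : ℕ) (a : S)
    (ha : a ∈ DSet S m) : a ∈ supClosure (DSet S k) := by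
  classical
  induction m generalizing a with
  | zero => exact subset_supClosure (DSet_mono S (Nat.zero_le k) ha)
  | succ m ih =>
    by_cases hirr : IsJoinIrreducible a
    · exact subset_supClosure (hS a hirr)
    obtain ⟨b, c, hb, hc, rfl⟩ := not_not.1 hirr
    have hV : IsNontrivialJoinCover (b ⊔ c) {b, c} := by
      refine ⟨isJoinCover_iff.2 ⟨⟨b, by simp⟩, fun d hd => ?_⟩, ?_⟩
      · exact sup_le (hd _ (by simp)) (hd _ (by simp))
      · intro v hv
        rw [Finset.mem_insert, Finset.mem_singleton] at hv
        rcases hv with rfl | rfl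
        · exact hb.not_ge
        · exact hc.not_ge
    obtain ⟨U, hU, href, hne, hcov⟩ := ha _ hV
    have : b ⊔ c = U.sup' hne id := by
      refine le_antisymm hcov (Finset.sup'_le _ _ fun u hu => ?_)
      obtain ⟨v, hv, huv⟩ := href u hu
      rw [Finset.mem_insert, Finset.mem_singleton] at hv
      rcases hv with rfl | rfl
      · exact le_sup_of_le_left huv
      · exact le_sup_of_le_right huv
    rw [this]
    exact supClosed_supClosure.finsetSup'_mem hne fun u hu => ih u (hU u hu)

/-- The least element of the preimage of a principal filter generated by an element of the
image. -/
theorem IsLowerBoundedLattice.exists_least {K L : Type} [Lattice K] [Lattice L]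
    (hL : IsLowerBoundedLattice L) (hK : IsFinitelyGeneratedLattice K) (f : LatticeHom K L)
    (w : K) : ∃ m, ∀ u, f w ≤ f u ↔ m ≤ u := by
  rcases hL K hK f (f w) with h | ⟨m, hm, hmin⟩
  · exact absurd (show w ∈ {u | f w ≤ f u} from le_rfl) (h ▸ Set.notMem_empty w)
  · exact ⟨m, fun u => ⟨fun h => hmin h, fun h => le_trans hm (OrderHomClass.mono f h)⟩⟩

/-- Elements of S are joins of elements of D_k, and the least preimage of a join is the join of the
least preimages. That T serves every S at once is what makes B_(n,k) finite. -/
theorem FreeLattice.exists_finite_least_preimages (α : Type) [Finite α] (k : ℕ) :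
    ∃ T : Set (FreeLattice α), T.Finite ∧ SupClosed T ∧ ∀ (S : Type) [Lattice S],
      IsLowerBoundedLattice S → DRankLE S k → ∀ f : LatticeHom (FreeLattice α) S,
        Function.Surjective f → ∀ w, ∃ t ∈ T, ∀ u, f w ≤ f u ↔ t ≤ u := by
  obtain ⟨M, hM, -, hMk⟩ := exists_finite_infClosed_DSet _ (isFinitelyGenerated α) k
  refine ⟨supClosure M, hM.supClosure, supClosed_supClosure, fun S _ hS hrank f hf w => ?_⟩
  have hleast := hS.exists_least (isFinitelyGenerated α) f
  obtain ⟨m, hm⟩ := exists_mem_DSet f hf hleast (f w)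
  refine supClosure_min (t := {b | ∃ t ∈ supClosure M, ∀ u, b ≤ f u ↔ t ≤ u}) ?_ ?_
    (mem_supClosure_DSet hrank m _ hm)
  · intro b hb
    obtain ⟨v, rfl⟩ := hf b
    obtain ⟨t, ht⟩ := hleast v
    obtain ⟨s, hs, hst, hbs⟩ := hMk S f _ hb t ((ht t).2 le_rfl)
    obtain rfl : s = t := le_antisymm hst ((ht s).1 hbs)
    exact ⟨s, subset_supClosure hs, ht⟩
  · rintro b ⟨t, ht, hbt⟩ c ⟨s, hs, hcs⟩
    refine ⟨t ⊔ s, supClosed_supClosure ht hs, fun u => ?_⟩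
    rw [sup_le_iff, sup_le_iff, hbt, hcs]

/-! ### The lattices `B_(n,k)` -/

/-- All the least elements lie in the finite set T, so only finitely many occur even for infinite R,
and their join serves all relations together. Working with relations on F turns a family indexed by
all lattices into a set. -/
theorem exists_least_forall_rel {F : Type*} [SemilatticeSup F] {T : Set F} (hT : T.Finite)
    (hsup : SupClosed T) (R : Set (F → F → Prop)) (hne : R.Nonempty)
    (h : ∀ r ∈ R, ∀ w, ∃ t ∈ T, ∀ u, r w u ↔ t ≤ u) (w : F) :
    ∃ t ∈ T, ∀ u, (∀ r ∈ R, r w u) ↔ t ≤ u := by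
  have hfin : {t ∈ T | ∃ r ∈ R, ∀ u, r w u ↔ t ≤ u}.Finite := hT.subset (Set.sep_subset ..)
  have hE : hfin.toFinset.Nonempty := by
    obtain ⟨r, hr⟩ := hne
    obtain ⟨t, ht, htu⟩ := h r hr w
    exact ⟨t, hfin.mem_toFinset.2 ⟨ht, r, hr, htu⟩⟩
  refine ⟨hfin.toFinset.sup' hE id,
    hsup.finsetSup'_mem hE fun t ht => (hfin.mem_toFinset.1 ht).1, fun u => ?_⟩
  rw [Finset.sup'_le_iff]
  constructor
  · intro hu t ht
    obtain ⟨-, r, hr, htu⟩ := hfin.mem_toFinset.1 ht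
    exact (htu u).1 (hu r hr)
  · intro hu r hr
    obtain ⟨t, ht, htu⟩ := h r hr w
    exact (htu u).2 (hu t (hfin.mem_toFinset.2 ⟨ht, r, hr, htu⟩))

theorem mem_DSet_of_subsingleton {L : Type*} [Lattice L] [Subsingleton L] (a : L) (k : ℕ) :
    a ∈ DSet L k := by
  refine DSet_mono L (Nat.zero_le k) fun V hV => ?_
  obtain ⟨v, hv⟩ := hV.1.1
  exact hV.2 v hv (Subsingleton.elim a v).le

theorem inBoundedVariety_of_subsingleton (k : ℕ) (L : Type) [Lattice L] [Subsingleton L] :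
    InBoundedVariety k L := fun S _ =>
  have h (M : Type) [Lattice M] [Subsingleton M] : IsLowerBoundedLattice M ∧ DRankLE M k :=
    ⟨isLowerBoundedLattice_of_DSet M fun a => ⟨0, mem_DSet_of_subsingleton a 0⟩,
      fun a _ => mem_DSet_of_subsingleton a k⟩
  ⟨h S, h Sᵒᵈ⟩

/-- Membership in V_k constrains only finitely generated sublattices, so f is corestricted to its
image. -/
theorem InBoundedVariety.exists_surjective {k : ℕ} {K L : Type} [Lattice K] [Lattice L]
    (hK : IsFinitelyGeneratedLattice K) (hL : InBoundedVariety k L) (f : LatticeHom K L) :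
    ∃ (S : Type) (_ : Lattice S) (g : LatticeHom K S), Function.Surjective g ∧
      (IsLowerBoundedLattice S ∧ DRankLE S k) ∧ (IsLowerBoundedLattice Sᵒᵈ ∧ DRankLE Sᵒᵈ k) ∧
      ∀ u v, g u ≤ g v ↔ f u ≤ f v := by
  let R : Sublattice L := Sublattice.map f ⊤
  let g : LatticeHom K R :=
    { toFun := fun u => ⟨f u, u, trivial, rfl⟩
      map_sup' := fun u v => Subtype.ext (map_sup f u v)
      map_inf' := fun u v => Subtype.ext (map_inf f u v) }
  have hg : Function.Surjective g := by
    rintro ⟨_, u, -, rfl⟩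
    exact ⟨u, rfl⟩
  have h := hL R (hK.of_surjective g hg)
  exact ⟨R, inferInstance, g, hg, h.1, h.2, fun u v => Iff.rfl⟩

namespace BoundedFree

theorem proj_surjective (n k : ℕ) : Function.Surjective (proj n k) := Quotient.mk_surjective

theorem proj_le_proj_iff {n k : ℕ} {w u : FreeLattice (Fin n)} :
    proj n k w ≤ proj n k u ↔ ∀ (L : Type) [Lattice L], InBoundedVariety k L →
      ∀ f : LatticeHom (FreeLattice (Fin n)) L, f w ≤ f u := by
  rw [← sup_eq_right, ← map_sup]
  constructor
  · intro h L _ hL f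
    rw [← sup_eq_right, ← map_sup]
    exact Quotient.exact h L hL f
  · intro h
    refine Quotient.sound fun L _ hL f => ?_
    rw [map_sup, sup_eq_right]
    exact h L hL f

theorem exists_finite_least (n k : ℕ) : ∃ T : Set (FreeLattice (Fin n)), T.Finite ∧
    ∀ w, ∃ t ∈ T, ∀ u, proj n k w ≤ proj n k u ↔ t ≤ u := by
  obtain ⟨T, hT, hsup, h⟩ := FreeLattice.exists_finite_least_preimages (Fin n) k
  refine ⟨T, hT, fun w => ?_⟩
  obtain ⟨t, ht, htu⟩ := exists_least_forall_rel hT hsup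
    {r | ∃ (L : Type) (_ : Lattice L) (f : LatticeHom (FreeLattice (Fin n)) L),
      InBoundedVariety k L ∧ r = fun w u => f w ≤ f u}
    -- The one-element lattice ensures that the family of relations is nonempty.
    ⟨_, PUnit, inferInstance, FreeLattice.lift fun _ => PUnit.unit,
      inBoundedVariety_of_subsingleton k PUnit, rfl⟩ (by
      rintro _ ⟨L, _, f, hL, rfl⟩ w
      obtain ⟨S, _, g, hg, hS, -, hgf⟩ :=
        hL.exists_surjective (FreeLattice.isFinitelyGenerated _) f
      obtain ⟨t, ht, htu⟩ := h S hS.1 hS.2 g hg w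
      exact ⟨t, ht, fun u => (hgf w u).symm.trans (htu u)⟩) w
  refine ⟨t, ht, fun u => ?_⟩
  rw [← htu, proj_le_proj_iff]
  constructor
  · rintro h' _ ⟨L, _, f, hL, rfl⟩
    exact h' L hL f
  · exact fun h' L _ hL f => h' _ ⟨L, _, f, hL, rfl⟩

theorem exists_greatest (n k : ℕ) (w : FreeLattice (Fin n)) :
    ∃ t, ∀ u, proj n k u ≤ proj n k w ↔ u ≤ t := by
  obtain ⟨T, hT, hsup, h⟩ := FreeLattice.exists_finite_least_preimages (Fin n) k
  obtain ⟨t, -, htu⟩ := exists_least_forall_rel hT hsup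
    {r | ∃ (L : Type) (_ : Lattice L) (f : LatticeHom (FreeLattice (Fin n)) L),
      InBoundedVariety k L ∧ r = fun w u => f u.flip ≤ f w.flip}
    ⟨_, PUnit, inferInstance, FreeLattice.lift fun _ => PUnit.unit,
      inBoundedVariety_of_subsingleton k PUnit, rfl⟩ (by
      rintro _ ⟨L, _, f, hL, rfl⟩ w
      obtain ⟨S, _, g, hg, -, hS, hgf⟩ :=
        hL.exists_surjective (FreeLattice.isFinitelyGenerated _) f
      obtain ⟨t, ht, htu⟩ := h Sᵒᵈ hS.1 hS.2
        ((LatticeHom.dual g).comp (FreeLattice.dualHom (Fin n))) (fun a => by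
          obtain ⟨v, hv⟩ := hg (OrderDual.ofDual a)
          refine ⟨v.flip, ?_⟩
          change OrderDual.toDual (g v.flip.flip) = a
          rw [FreeLattice.flip_flip, hv]
          rfl) w
      exact ⟨t, ht, fun u => (hgf u.flip w.flip).symm.trans (htu u)⟩) w.flip
  refine ⟨t.flip, fun u => ?_⟩
  rw [FreeLattice.le_flip_iff, ← htu, proj_le_proj_iff]
  constructor
  · rintro h' _ ⟨L, _, f, hL, rfl⟩
    simpa using h' L hL f
  · intro h' L _ hL f
    simpa using h' _ ⟨L, _, f, hL, rfl⟩

theorem exists_least (n k : ℕ) (w : FreeLattice (Fin n)) :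
    ∃ t, ∀ u, proj n k w ≤ proj n k u ↔ t ≤ u :=
  let ⟨_, _, h⟩ := exists_finite_least n k
  let ⟨t, _, ht⟩ := h w
  ⟨t, ht⟩

instance (n k : ℕ) : Finite (BoundedFree n k) := by
  obtain ⟨T, hT, h⟩ := exists_finite_least n k
  have : Finite T := hT
  refine Finite.of_surjective (fun t : T => proj n k t) fun b => ?_
  obtain ⟨w, rfl⟩ := proj_surjective n k b
  obtain ⟨t, ht, htu⟩ := h w
  exact ⟨⟨t, ht⟩, le_antisymm (OrderHomClass.mono _ ((htu w).1 le_rfl)) ((htu t).2 le_rfl)⟩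

theorem exists_mem_DSet (n k : ℕ) (b : BoundedFree n k) : ∃ m, b ∈ DSet (BoundedFree n k) m :=
  FreeLattice.exists_mem_DSet (proj n k) (proj_surjective n k) (exists_least n k) b

theorem exists_mem_DSet_dual (n k : ℕ) (b : (BoundedFree n k)ᵒᵈ) :
    ∃ m, b ∈ DSet (BoundedFree n k)ᵒᵈ m := by
  refine FreeLattice.exists_mem_DSet
    ((LatticeHom.dual (proj n k)).comp (FreeLattice.dualHom (Fin n))) (fun a => ?_)
    (fun w => ?_) b
  · obtain ⟨v, hv⟩ := proj_surjective n k (OrderDual.ofDual a)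
    refine ⟨v.flip, ?_⟩
    change OrderDual.toDual (proj n k v.flip.flip) = a
    rw [FreeLattice.flip_flip, hv]
    rfl
  · obtain ⟨t, ht⟩ := exists_greatest n k w.flip
    exact ⟨t.flip, fun u => (ht u.flip).trans
      ⟨fun h => by simpa using FreeLattice.flip_le_flip h,
        fun h => by simpa using FreeLattice.flip_le_flip h⟩⟩

end BoundedFree

/-! ### Finite bounded lattices -/

theorem eq_empty_or_exists_isLeast_inter {K : Type*} [SemilatticeSup K] {s t : Set K}
    (hs : IsUpperSet s) (ht : IsUpperSet t) (hs' : s = ∅ ∨ ∃ m, IsLeast s m)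
    (ht' : t = ∅ ∨ ∃ m, IsLeast t m) : s ∩ t = ∅ ∨ ∃ m, IsLeast (s ∩ t) m := by
  rcases hs' with rfl | ⟨m, hm, hmin⟩
  · exact Or.inl (Set.empty_inter t)
  rcases ht' with rfl | ⟨m', hm', hmin'⟩
  · exact Or.inl (Set.inter_empty s)
  · exact Or.inr ⟨m ⊔ m', ⟨hs le_sup_left hm, ht le_sup_right hm'⟩,
      fun u hu => sup_le (hmin hu.1) (hmin' hu.2)⟩

theorem isUpperSet_preimage {K L : Type*} [Lattice K] [Lattice L] (f : LatticeHom K L) (a : L) :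
    IsUpperSet {u | a ≤ f u} := fun _ _ huv hu => le_trans hu (OrderHomClass.mono f huv)

/-- A subdirect product of two lower bounded lattices is lower bounded. -/
theorem IsLowerBoundedLattice.of_subdirect {A B C : Type} [Lattice A] [Lattice B] [Lattice C]
    (hA : IsLowerBoundedLattice A) (hB : IsLowerBoundedLattice B) (f : LatticeHom C A)
    (g : LatticeHom C B) (h : ∀ c d, c ≤ d ↔ f c ≤ f d ∧ g c ≤ g d) :
    IsLowerBoundedLattice C := by
  intro K _ hK e a
  have : {u | a ≤ e u} = {u | f a ≤ f.comp e u} ∩ {u | g a ≤ g.comp e u} :=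
    Set.ext fun u => h a (e u)
  rw [this]
  exact eq_empty_or_exists_isLeast_inter (isUpperSet_preimage _ _) (isUpperSet_preimage _ _)
    (hA K hK _ _) (hB K hK _ _)

theorem IsLowerBoundedLattice.of_embedding {A C : Type} [Lattice A] [Lattice C]
    (hA : IsLowerBoundedLattice A) (f : LatticeHom C A) (h : ∀ c d, c ≤ d ↔ f c ≤ f d) :
    IsLowerBoundedLattice C :=
  hA.of_subdirect hA f f fun c d => by rw [h, and_self]

/-- The abstract form of the fact that doubling an interval preserves lower boundedness. -/
theorem IsLowerBoundedLattice.of_doubling {A B : Type} [Lattice A] [Lattice B] [Finite A]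
    (hA : IsLowerBoundedLattice A) (f : LatticeHom B A) (b : B)
    (hle : ∀ e, (∀ z, e ≤ z ↔ f e ≤ f z) ∨ ∀ z, e ≤ z ↔ f e ≤ f z ∧ b ≤ z)
    (hsup : ∀ z w, ¬ b ≤ z → ¬ b ≤ w → b ≤ z ⊔ w → ∀ x, f (z ⊔ w) ≤ f x → b ≤ x) :
    IsLowerBoundedLattice B := by
  intro K _ hK g e
  have hb : {u | b ≤ g u} = ∅ ∨ ∃ m, IsLeast {u | b ≤ g u} m := by
    obtain ⟨Y, hY⟩ := id hK
    -- A join that reaches b although neither joinand does owes this to its image in A alone, so the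
    -- least preimage of that image already reaches b. Since A is finite, finitely many such
    -- elements arise.
    have hfin : (⋃ d : A, {m | IsLeast {u | d ≤ f.comp g u} m}).Finite :=
      Set.finite_iUnion fun d => Set.Subsingleton.finite fun m hm m' hm' =>
        IsLeast.unique hm hm'
    refine eq_empty_or_exists_isLeast g b (Y.finite_toSet.union hfin).infClosure
      (exists_mem_le_of_generates hY (Set.subset_union_left.trans subset_infClosure)
        infClosed_infClosure g b fun u v hu hv huv => ?_)
    rcases hA K hK (f.comp g) (f.comp g (u ⊔ v)) with h | ⟨m, hm⟩
    · exact absurd (show u ⊔ v ∈ {w | f.comp g (u ⊔ v) ≤ f.comp g w} from le_rfl)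
        (h ▸ Set.notMem_empty _)
    · refine ⟨m, subset_infClosure (Or.inr (Set.mem_iUnion.2 ⟨_, hm⟩)), hm.2 le_rfl, ?_⟩
      refine hsup (g u) (g v) hu hv (by rwa [← map_sup]) (g m) ?_
      rw [← map_sup g]
      exact hm.1
  rcases hle e with he | he
  · have : {u | e ≤ g u} = {u | f e ≤ f.comp g u} := Set.ext fun u => he (g u)
    rw [this]
    exact hA K hK _ _
  · have : {u | e ≤ g u} = {u | f e ≤ f.comp g u} ∩ {u | b ≤ g u} := Set.ext fun u => he (g u)
    rw [this]
    exact eq_empty_or_exists_isLeast_inter (isUpperSet_preimage _ _) (isUpperSet_preimage _ _)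
      (hA K hK _ _) hb

/-- Finite lattices that are lower and upper bounded. -/
structure IsFiniteBounded (A : Type) [Lattice A] : Prop where
  finite : Finite A
  lower : IsLowerBoundedLattice A
  upper : IsLowerBoundedLattice Aᵒᵈ

theorem isFiniteBounded_prop : IsFiniteBounded Prop where
  finite := inferInstance
  lower := isLowerBoundedLattice_of_DSet _ fun a => ⟨0, fun V hV => by
    have h := isJoinCover_iff.1 hV.1
    have ha : a ≤ False := h.2 _ fun v hv hv' => hV.2 v hv fun _ => hv'
    obtain ⟨v, hv⟩ := h.1
    exact hV.2 v hv fun h' => (ha h').elim⟩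
  upper := isLowerBoundedLattice_of_DSet _ fun a => ⟨0, fun V hV => by
    have h := isJoinCover_iff.1 hV.1
    have ha : a ≤ OrderDual.toDual True := h.2 _ fun v hv _ => by_contra fun hv' =>
      hV.2 v hv fun h' => (hv' h').elim
    obtain ⟨v, hv⟩ := h.1
    exact hV.2 v hv fun _ => ha trivial⟩

theorem IsFiniteBounded.prod {A B : Type} [Lattice A] [Lattice B] (hA : IsFiniteBounded A)
    (hB : IsFiniteBounded B) : IsFiniteBounded (A × B) where
  finite := have := hA.finite; have := hB.finite; inferInstance
  lower := hA.lower.of_subdirect hB.lower LatticeHom.fst LatticeHom.snd fun _ _ => Iff.rfl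
  upper := hA.upper.of_subdirect hB.upper (LatticeHom.dual LatticeHom.fst)
    (LatticeHom.dual LatticeHom.snd) fun _ _ => Iff.rfl

theorem IsFiniteBounded.doubledInterval {A : Type} [Lattice A] (hA : IsFiniteBounded A)
    (p q : A) : IsFiniteBounded (DoubledInterval p q) where
  finite := have := hA.finite; inferInstance
  lower := by
    have := hA.finite
    refine hA.lower.of_doubling (DoubledInterval.fstHom p q)
      ⟨(p, True), fun _ => le_rfl, fun _ h => (h trivial).elim⟩ (fun e => ?_) ?_
    · by_cases he : e.1.2
      · exact Or.inr fun z => ⟨fun h => ⟨h.1, z.2.1 (h.2 he), fun _ => h.2 he⟩,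
          fun h => ⟨h.1, fun _ => h.2.2 trivial⟩⟩
      · exact Or.inl fun z => ⟨fun h => h.1, fun h => ⟨h, fun h' => (he h').elim⟩⟩
    · intro z w hz hw h x hx
      have hz' : ¬ z.1.2 := fun h' => hz ⟨z.2.1 h', fun _ => h'⟩
      have hw' : ¬ w.1.2 := fun h' => hw ⟨w.2.1 h', fun _ => h'⟩
      rcases h.2 trivial with h | h | h
      · exact (hz' h).elim
      · exact (hw' h).elim
      · have hx' : x.1.2 := by_contra fun hn =>
          h.2 (le_trans hx (x.2.2 (le_trans h.1 hx) hn))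
        exact ⟨x.2.1 hx', fun _ => hx'⟩
  upper := by
    have := hA.finite
    refine hA.upper.of_doubling (LatticeHom.dual (DoubledInterval.fstHom p q))
      (OrderDual.toDual ⟨(q, False), fun h => h.elim, fun _ _ => le_rfl⟩)
      (OrderDual.rec fun e => ?_) (OrderDual.rec fun z => OrderDual.rec fun w => ?_)
    · by_cases he : e.1.2
      · exact Or.inl (OrderDual.rec fun z => ⟨fun h => h.1, fun h => ⟨h, fun _ => he⟩⟩)
      by_cases hq : e.1.1 ≤ q
      · exact Or.inr (OrderDual.rec fun z =>
          ⟨fun h => ⟨h.1, le_trans h.1 hq, fun h' => he (h.2 h')⟩,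
            fun h => ⟨h.1, fun h' => (h.2.2 h').elim⟩⟩)
      · exact Or.inl (OrderDual.rec fun z => ⟨fun h => h.1, fun h => ⟨h, fun h' =>
          (hq (e.2.2 (le_trans (z.2.1 h') h) he)).elim⟩⟩)
    · intro hz hw h
      refine OrderDual.rec fun x hx => ?_
      have hx' : x.1.1 ≤ z.1.1 ⊓ w.1.1 := hx
      have hn : ¬ (z.1.2 ∧ w.1.2) := h.2
      refine ⟨le_trans hx' h.1, fun hp => ?_⟩
      have hp' := (x.2.1 hp).trans hx'
      by_cases hz' : z.1.2
      · have hw' : ¬ w.1.2 := fun h' => hn ⟨hz', h'⟩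
        exact hw ⟨w.2.2 (hp'.trans inf_le_right) hw', hw'⟩
      · exact hz ⟨z.2.2 (hp'.trans inf_le_left) hz', hz'⟩

/-- A finite lattice is an image of the free lattice on its own elements, with least preimages by
lower boundedness; finiteness makes the rank uniform. -/
theorem IsLowerBoundedLattice.exists_forall_mem_DSet {S : Type} [Lattice S] [Finite S]
    (hS : IsLowerBoundedLattice S) : ∃ m, ∀ a : S, a ∈ DSet S m := by
  have h (a : S) : ∃ m, a ∈ DSet S m :=
    FreeLattice.exists_mem_DSet (FreeLattice.lift id) (fun a => ⟨_, FreeLattice.lift_of id a⟩)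
      (hS.exists_least (FreeLattice.isFinitelyGenerated S) _) a
  choose m hm using h
  obtain ⟨N, hN⟩ := (Set.finite_range m).bddAbove
  exact ⟨N, fun a => DSet_mono S (hN ⟨a, rfl⟩) (hm a)⟩

theorem IsFiniteBounded.exists_inBoundedVariety {A : Type} [Lattice A] (hA : IsFiniteBounded A) :
    ∃ k, InBoundedVariety k A := by
  have := hA.finite
  have hlow (S : Sublattice A) : IsLowerBoundedLattice S :=
    hA.lower.of_embedding S.subtype fun _ _ => Iff.rfl
  have hupp (S : Sublattice A) : IsLowerBoundedLattice (S : Type)ᵒᵈ :=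
    hA.upper.of_embedding (LatticeHom.dual S.subtype) fun _ _ => Iff.rfl
  have hfin : Finite (Sublattice A) := Finite.of_injective _ SetLike.coe_injective
  choose m hm using fun S : Sublattice A => (hlow S).exists_forall_mem_DSet
  choose m' hm' using fun S : Sublattice A => (hupp S).exists_forall_mem_DSet
  obtain ⟨N, hN⟩ := (Set.finite_range m).bddAbove
  obtain ⟨N', hN'⟩ := (Set.finite_range m').bddAbove
  refine ⟨max N N', fun S _ => ⟨⟨hlow S, fun a _ => ?_⟩, ⟨hupp S, fun a _ => ?_⟩⟩⟩
  · exact DSet_mono _ (le_max_of_le_left (hN ⟨S, rfl⟩)) (hm S a)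
  · exact DSet_mono _ (le_max_of_le_right (hN' ⟨S, rfl⟩)) (hm' S a)

theorem BoundedFree.isFiniteBounded (n k : ℕ) : IsFiniteBounded (BoundedFree n k) where
  finite := inferInstance
  lower := isLowerBoundedLattice_of_DSet _ (exists_mem_DSet n k)
  upper := isLowerBoundedLattice_of_DSet _ (exists_mem_DSet_dual n k)

/-! ### Free lattices are residually finite bounded -/

/-- The homomorphism to a product with given components. -/
def LatticeHom.prodMk {K A B : Type*} [Lattice K] [Lattice A] [Lattice B] (f : LatticeHom K A)
    (g : LatticeHom K B) : LatticeHom K (A × B) where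
  toFun u := (f u, g u)
  map_sup' u v := Prod.ext (map_sup f u v) (map_sup g u v)
  map_inf' u v := Prod.ext (map_inf f u v) (map_inf g u v)

namespace FreeLattice

theorem exists_isFiniteBounded_not_le {α : Type*} (p q : LatticeTerm α) (h : ¬ mk p ≤ mk q) :
    ∃ (A : Type) (_ : Lattice A) (g : LatticeHom (FreeLattice α) A),
      IsFiniteBounded A ∧ ¬ g (mk p) ≤ g (mk q) := by
  match p, q, h with
  | .var a, q, h =>
    refine ⟨Prop, inferInstance, lift fun b => b = a, isFiniteBounded_prop, fun h' => h ?_⟩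
    refine (of_le_iff a _).2 (h' ?_)
    exact (of_le_iff a _).1 le_rfl
  | .sup p₁ p₂, q, h =>
    have : ¬ mk p₁ ≤ mk q ∨ ¬ mk p₂ ≤ mk q := by
      by_contra! hn
      exact h (sup_le (a := mk p₁) (b := mk p₂) hn.1 hn.2)
    rcases this with h₁ | h₁
    · obtain ⟨A, _, g, hA, hg⟩ := exists_isFiniteBounded_not_le p₁ q h₁
      exact ⟨A, _, g, hA, fun h' => hg (le_trans (OrderHomClass.mono g
        (le_sup_left (a := mk p₁) (b := mk p₂))) h')⟩
    · obtain ⟨A, _, g, hA, hg⟩ := exists_isFiniteBounded_not_le p₂ q h₁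
      exact ⟨A, _, g, hA, fun h' => hg (le_trans (OrderHomClass.mono g
        (le_sup_right (a := mk p₁) (b := mk p₂))) h')⟩
  | .inf p₁ p₂, .var a, h =>
    refine ⟨Prop, inferInstance, lift fun b => b ≠ a, isFiniteBounded_prop, fun h' => h ?_⟩
    exact (le_of_iff a _).2 fun h'' => (le_of_iff a _).1 le_rfl (h' h'')
  | .inf p₁ p₂, .inf q₁ q₂, h =>
    have : ¬ mk (.inf p₁ p₂) ≤ mk q₁ ∨ ¬ mk (.inf p₁ p₂) ≤ mk q₂ := by
      by_contra! hn
      have : mk (.inf p₁ p₂) ≤ mk q₁ ⊓ mk q₂ := le_inf hn.1 hn.2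
      exact h this
    rcases this with h₁ | h₁
    · obtain ⟨A, _, g, hA, hg⟩ := exists_isFiniteBounded_not_le (.inf p₁ p₂) q₁ h₁
      exact ⟨A, _, g, hA, fun h' => hg (le_trans h' (OrderHomClass.mono g
        (inf_le_left (a := mk q₁) (b := mk q₂))))⟩
    · obtain ⟨A, _, g, hA, hg⟩ := exists_isFiniteBounded_not_le (.inf p₁ p₂) q₂ h₁
      exact ⟨A, _, g, hA, fun h' => hg (le_trans h' (OrderHomClass.mono g
        (inf_le_right (a := mk q₁) (b := mk q₂))))⟩
  | .inf p₁ p₂, .sup q₁ q₂, h =>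
    obtain ⟨A, _, a, hA, ha⟩ := exists_isFiniteBounded_not_le p₁ (.sup q₁ q₂) fun h' =>
      h ((inf_le_left (a := mk p₁) (b := mk p₂)).trans h')
    obtain ⟨B, _, b, hB, hb⟩ := exists_isFiniteBounded_not_le p₂ (.sup q₁ q₂) fun h' =>
      h ((inf_le_right (a := mk p₁) (b := mk p₂)).trans h')
    obtain ⟨C, _, c, hC, hc⟩ := exists_isFiniteBounded_not_le (.inf p₁ p₂) q₁ fun h' =>
      h (h'.trans (le_sup_left (a := mk q₁) (b := mk q₂)))
    obtain ⟨D, _, d, hD, hd⟩ := exists_isFiniteBounded_not_le (.inf p₁ p₂) q₂ fun h' =>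
      h (h'.trans (le_sup_right (a := mk q₁) (b := mk q₂)))
    -- The product retains the failure of all four alternatives of (W), so doubling the interval
    -- there separates the two terms.
    let f := LatticeHom.prodMk (LatticeHom.prodMk a b) (LatticeHom.prodMk c d)
    have hf : ∀ u v, f u ≤ f v ↔ (a u ≤ a v ∧ b u ≤ b v) ∧ c u ≤ c v ∧ d u ≤ d v :=
      fun u v => Iff.rfl
    obtain ⟨g, hg⟩ :=
      exists_lift_doubledInterval (f (mk (.inf p₁ p₂))) (f (mk (.sup q₁ q₂))) f
    refine ⟨_, inferInstance, g, ((hA.prod hB).prod (hC.prod hD)).doubledInterval _ _, ?_⟩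
    have hp : g (mk (.inf p₁ p₂)) = g (mk p₁) ⊓ g (mk p₂) := map_inf g (mk p₁) (mk p₂)
    have hq : g (mk (.sup q₁ q₂)) = g (mk q₁) ⊔ g (mk q₂) := map_sup g (mk q₁) (mk q₂)
    rw [hp, hq]
    refine DoubledInterval.not_inf_le_sup ?_ ?_ ?_ ?_ ?_ ?_
    · rw [hg, hg, ← map_inf]; rfl
    · rw [hg, hg, ← map_sup]; rfl
    · rw [hg, hf]; exact fun h => ha h.1.1
    · rw [hg, hf]; exact fun h => hb h.1.2
    · rw [hg, hf]; exact fun h => hc h.2.1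
    · rw [hg, hf]; exact fun h => hd h.2.2
termination_by p.size + q.size
decreasing_by all_goals simp only [LatticeTerm.size]; omega

end FreeLattice

theorem BoundedFree.le_of_forall_proj_le {n : ℕ} {u v : FreeLattice (Fin n)}
    (h : ∀ k, proj n k u ≤ proj n k v) : u ≤ v := by
  obtain ⟨p⟩ := u
  obtain ⟨q⟩ := v
  by_contra hn
  obtain ⟨A, _, g, hA, hg⟩ := FreeLattice.exists_isFiniteBounded_not_le p q hn
  obtain ⟨k, hk⟩ := hA.exists_inBoundedVariety
  exact hg (proj_le_proj_iff.1 (h k) A hk g)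

/-! ### Semidistributivity -/

/-- An element of E outside N lies outside X and outside Y or Z, so one of the two join
representations is a nontrivial cover inside E. Its refinement has lower D-level and stays in E,
hence lies in N by induction, and so does the join. The intended case is E = X ∨ Y = X ∨ Z and N = X
∨ (Y ∧ Z). -/
theorem mem_ideal_of_mem_DSet {L : Type*} [Lattice L] {X Y Z E N : Order.Ideal L}
    (hXY : ∀ a ∈ E, ∃ x ∈ X, ∃ y ∈ Y, a ≤ x ⊔ y) (hXZ : ∀ a ∈ E, ∃ x ∈ X, ∃ z ∈ Z, a ≤ x ⊔ z)
    (hX : X ≤ N) (hYZ : ∀ a, a ∈ Y → a ∈ Z → a ∈ N)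
    (hXE : X ≤ E) (hYE : Y ≤ E) (hZE : Z ≤ E) (m : ℕ) :
    ∀ a ∈ DSet L m, a ∈ E → a ∈ N := by
  classical
  have pair {a x y : L} (hx : ¬ a ≤ x) (hy : ¬ a ≤ y) (h : a ≤ x ⊔ y) :
      IsNontrivialJoinCover a {x, y} := by
    refine ⟨isJoinCover_iff.2 ⟨⟨x, by simp⟩, fun b hb => h.trans ?_⟩, by simp [hx, hy]⟩
    exact sup_le (hb _ (by simp)) (hb _ (by simp))
  have split (a : L) (ha : a ∈ E) : a ∈ N ∨ ∃ V : Finset L, IsNontrivialJoinCover a V ∧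
      ∀ v ∈ V, v ∈ E := by
    by_cases haX : a ∈ X
    · exact Or.inl (hX haX)
    obtain ⟨x, hx, y, hy, hxy⟩ := hXY a ha
    obtain ⟨x', hx', z, hz, hxz⟩ := hXZ a ha
    by_cases haY : a ∈ Y
    · by_cases haZ : a ∈ Z
      · exact Or.inl (hYZ a haY haZ)
      · refine Or.inr ⟨{x', z}, pair (fun h => haX (X.lower h hx')) (fun h => haZ (Z.lower h hz))
          hxz, ?_⟩
        simpa using ⟨hXE hx', hZE hz⟩
    · refine Or.inr ⟨{x, y}, pair (fun h => haX (X.lower h hx)) (fun h => haY (Y.lower h hy))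
          hxy, ?_⟩
      simpa using ⟨hXE hx, hYE hy⟩
  induction m with
  | zero =>
    intro a ha haE
    rcases split a haE with h | ⟨V, hV, -⟩
    · exact h
    · exact absurd hV (ha V)
  | succ m ih =>
    intro a ha haE
    rcases split a haE with h | ⟨V, hV, hVE⟩
    · exact h
    · obtain ⟨U, hU, href, hne, hcov⟩ := ha V hV
      refine N.lower hcov (SupClosed.finsetSup'_mem (s := (N : Set L))
        (fun _ h _ h' => Order.Ideal.sup_mem h h') hne fun u hu => ih u (hU u hu) ?_)
      obtain ⟨v, hv, huv⟩ := href u hu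
      exact E.lower huv (hVE v hv)

theorem joinSemidistributive_of_DSet {L : Type*} [Lattice L] (h : ∀ a : L, ∃ m, a ∈ DSet L m) :
    JoinSemidistributive L := by
  intro x y z hxyz
  refine le_antisymm ?_ (sup_le_sup_left inf_le_left x)
  obtain ⟨m, hm⟩ := h (x ⊔ y)
  exact mem_ideal_of_mem_DSet (X := .principal x) (Y := .principal y) (Z := .principal z)
    (E := .principal (x ⊔ y)) (N := .principal (x ⊔ y ⊓ z))
    (fun a ha => ⟨x, Order.Ideal.mem_principal_self, y, Order.Ideal.mem_principal_self, ha⟩)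
    (fun a ha => ⟨x, Order.Ideal.mem_principal_self, z, Order.Ideal.mem_principal_self,
      le_trans ha hxyz.le⟩)
    (Order.Ideal.principal_le_iff.2 le_sup_left)
    (fun a h₁ h₂ => le_sup_of_le_right (le_inf h₁ h₂))
    (Order.Ideal.principal_le_iff.2 le_sup_left)
    (Order.Ideal.principal_le_iff.2 le_sup_right)
    (Order.Ideal.principal_le_iff.2 (le_sup_right.trans hxyz.ge)) m _ hm le_rfl

theorem joinSemidistributive_ideal_of_DSet {L : Type*} [Lattice L]
    (h : ∀ a : L, ∃ m, a ∈ DSet L m) : JoinSemidistributive (Order.Ideal L) := by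
  intro X Y Z hXYZ
  refine le_antisymm (fun a ha => ?_) (sup_le_sup_left inf_le_left X)
  obtain ⟨m, hm⟩ := h a
  refine mem_ideal_of_mem_DSet (X := X) (Y := Y) (Z := Z) (E := X ⊔ Y) (N := X ⊔ Y ⊓ Z)
    (fun a ha => Order.Ideal.mem_sup.1 ha) (fun a ha => ?_) le_sup_left
    (fun a h₁ h₂ => (le_sup_right : Y ⊓ Z ≤ X ⊔ Y ⊓ Z) (Order.Ideal.mem_inf.2 ⟨h₁, h₂⟩))
    le_sup_left le_sup_right (le_sup_right.trans hXYZ.ge) m a hm ha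
  rw [hXYZ] at ha
  exact Order.Ideal.mem_sup.1 ha

theorem meetSemidistributive_of_dual {L : Type*} [Lattice L]
    (h : JoinSemidistributive Lᵒᵈ) : MeetSemidistributive L := h

theorem MeetSemidistributive.of_orderIso {L M : Type*} [Lattice L] [Lattice M] (e : L ≃o M)
    (h : MeetSemidistributive L) : MeetSemidistributive M := by
  intro x y z hxyz
  have := h (e.symm x) (e.symm y) (e.symm z) (by rw [← map_inf, ← map_inf, hxyz])
  rw [← map_inf, ← map_sup, ← map_inf] at this
  exact e.symm.injective this

theorem FreeLattice.exists_mem_DSet_self {α : Type*} (w : FreeLattice α) :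
    ∃ m, w ∈ DSet (FreeLattice α) m :=
  exists_mem_DSet (LatticeHom.id _) Function.surjective_id (fun w => ⟨w, fun _ => Iff.rfl⟩) w

theorem WhitmanCondition.ideal {L : Type*} [Lattice L] (hL : WhitmanCondition L) :
    WhitmanCondition (Order.Ideal L) := by
  intro S T U V h
  by_contra! hn
  obtain ⟨hs, ht, hu, hv⟩ := hn
  obtain ⟨s, hsS, hs⟩ := SetLike.not_le_iff_exists.1 hs
  obtain ⟨t, htT, ht⟩ := SetLike.not_le_iff_exists.1 ht
  obtain ⟨a, ha, hu⟩ := SetLike.not_le_iff_exists.1 hu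
  obtain ⟨b, hb, hv⟩ := SetLike.not_le_iff_exists.1 hv
  rw [Order.Ideal.mem_inf] at ha hb
  -- Enlarging s and t by a ∨ b puts a and b below the meet, so one pair of representatives
  -- witnesses all four failures.
  have hs' : s ⊔ (a ⊔ b) ∈ S := Order.Ideal.sup_mem hsS (Order.Ideal.sup_mem ha.1 hb.1)
  have ht' : t ⊔ (a ⊔ b) ∈ T := Order.Ideal.sup_mem htT (Order.Ideal.sup_mem ha.2 hb.2)
  have hmem : (s ⊔ (a ⊔ b)) ⊓ (t ⊔ (a ⊔ b)) ∈ U ⊔ V := h (Order.Ideal.mem_inf.2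
    ⟨S.lower inf_le_left hs', T.lower inf_le_right ht'⟩)
  have hab : a ⊔ b ≤ (s ⊔ (a ⊔ b)) ⊓ (t ⊔ (a ⊔ b)) := le_inf le_sup_right le_sup_right
  obtain ⟨u, huU, v, hvV, huv⟩ := Order.Ideal.mem_sup.1 hmem
  have hUV : u ⊔ v ∈ U ⊔ V := Order.Ideal.mem_sup.2 ⟨u, huU, v, hvV, le_rfl⟩
  rcases hL _ _ _ _ huv with h | h | h | h
  · exact hs ((U ⊔ V).lower (le_sup_left.trans h) hUV)
  · exact ht ((U ⊔ V).lower (le_sup_left.trans h) hUV)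
  · exact hu (U.lower (le_sup_left.trans (hab.trans h)) huU)
  · exact hv (V.lower (le_sup_right.trans (hab.trans h)) hvV)

/-! ### The profinite-bounded completion -/

theorem FreeLattice.exists_forall_le {n : ℕ} (hn : 1 ≤ n) :
    ∃ b : FreeLattice (Fin n), ∀ w, b ≤ w := by
  have : Nonempty (Fin n) := ⟨⟨0, hn⟩⟩
  refine ⟨Finset.univ.inf' Finset.univ_nonempty of, fun w => ?_⟩
  induction w using induction_on with
  | of a => exact Finset.inf'_le _ (Finset.mem_univ a)
  | sup u v hu _ => exact le_sup_of_le_left hu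
  | inf u v hu hv => exact le_inf hu hv

namespace profiniteBoundedCompletion

open BoundedFree

variable {n : ℕ}

theorem transition_apply (c : profiniteBoundedCompletion n) {k l : ℕ} (h : k ≤ l) :
    transition n h (c.1 l) = c.1 k := c.2 k l h

theorem le_of_le {c d : profiniteBoundedCompletion n} {k l : ℕ} (h : k ≤ l)
    (hcd : c.1 l ≤ d.1 l) : c.1 k ≤ d.1 k := by
  rw [← transition_apply c h, ← transition_apply d h]
  exact OrderHomClass.mono _ hcd

theorem exists_not_le {c d : profiniteBoundedCompletion n} (h : ¬ c ≤ d) :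
    ∃ k, ∀ l, k ≤ l → ¬ c.1 l ≤ d.1 l := by
  have : ¬ ∀ k, c.1 k ≤ d.1 k := h
  push Not at this
  obtain ⟨k, hk⟩ := this
  exact ⟨k, fun l hl h' => hk (le_of_le hl h')⟩

theorem proj_eq_of_le (c : profiniteBoundedCompletion n) {k l : ℕ} (h : k ≤ l)
    {w : FreeLattice (Fin n)} (hw : proj n l w = c.1 l) : proj n k w = c.1 k := by
  rw [← transition_proj n h, hw, transition_apply]

/-- Every component has a greatest preimage, which is above all components. -/
theorem exists_greatest (c : profiniteBoundedCompletion n) (k : ℕ) :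
    ∃ t, proj n k t = c.1 k ∧ ∀ l, c.1 l ≤ proj n l t := by
  obtain ⟨w, hw⟩ := proj_surjective n k (c.1 k)
  obtain ⟨t, ht⟩ := BoundedFree.exists_greatest n k w
  have hwt : w ≤ t := (ht w).1 le_rfl
  refine ⟨t, le_antisymm (((ht t).2 le_rfl).trans hw.le)
    (hw.ge.trans (OrderHomClass.mono _ hwt)), fun l => ?_⟩
  rcases le_total l k with h | h
  · rw [← proj_eq_of_le c h hw]
    exact OrderHomClass.mono _ hwt
  -- A preimage of the component at l ≥ k also maps to the component at k, hence lies below the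
  -- greatest preimage.
  · obtain ⟨v, hv⟩ := proj_surjective n l (c.1 l)
    rw [← hv]
    exact OrderHomClass.mono _ ((ht v).1 ((proj_eq_of_le c h hv).trans hw.symm).le)

/-- Every component has a least preimage, which is below all components. -/
theorem exists_least (c : profiniteBoundedCompletion n) (k : ℕ) :
    ∃ t, proj n k t = c.1 k ∧ ∀ l, proj n l t ≤ c.1 l := by
  obtain ⟨w, hw⟩ := proj_surjective n k (c.1 k)
  obtain ⟨t, ht⟩ := BoundedFree.exists_least n k w
  have hwt : t ≤ w := (ht w).1 le_rfl
  refine ⟨t, le_antisymm ((OrderHomClass.mono (proj n k) hwt).trans hw.le)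
    (hw.ge.trans ((ht t).2 le_rfl)), fun l => ?_⟩
  rcases le_total l k with h | h
  · rw [← proj_eq_of_le c h hw]
    exact OrderHomClass.mono _ hwt
  · obtain ⟨v, hv⟩ := proj_surjective n l (c.1 l)
    rw [← hv]
    exact OrderHomClass.mono _ ((ht v).1 (hw.trans (proj_eq_of_le c h hv).symm).le)

/-- The cut of the free lattice that is determined by an element of the completion. -/
def toDedekindCut (c : profiniteBoundedCompletion n) : DedekindCut (FreeLattice (Fin n)) where
  extent := {w | ∀ k, proj n k w ≤ c.1 k}
  intent := {w | ∀ k, c.1 k ≤ proj n k w}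
  upperPolar_extent := by
    refine Set.Subset.antisymm (fun u hu k => ?_)
      fun u hu w hw => le_of_forall_proj_le fun k => (hw k).trans (hu k)
    -- The least preimage t lies in the extent, so every upper bound of the extent is above t and
    -- projects above the component at k.
    obtain ⟨t, ht, htl⟩ := exists_least c k
    rw [← ht]
    exact OrderHomClass.mono _ (hu htl)
  lowerPolar_intent := by
    refine Set.Subset.antisymm (fun w hw k => ?_)
      fun w hw u hu => le_of_forall_proj_le fun k => (hw k).trans (hu k)
    obtain ⟨t, ht, htl⟩ := exists_greatest c k
    rw [← ht]
    exact OrderHomClass.mono _ (hw htl)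

theorem toDedekindCut_le_iff (c d : profiniteBoundedCompletion n) :
    toDedekindCut c ≤ toDedekindCut d ↔ c ≤ d := by
  constructor
  · intro h k
    obtain ⟨t, ht, htl⟩ := exists_least c k
    have : t ∈ (toDedekindCut d).extent := h htl
    rw [← ht]
    exact this k
  · exact fun h w hw k => (hw k).trans (h k)

theorem toDedekindCut_surjective (hn : 1 ≤ n) :
    Function.Surjective (toDedekindCut (n := n)) := by
  intro C
  have hmem (w) : w ∈ C.extent ↔ ∀ u ∈ C.intent, w ≤ u := by
    rw [← C.lowerPolar_intent]
    rfl
  obtain ⟨b, hb⟩ := FreeLattice.exists_forall_le hn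
  have hsup : SupClosed C.extent := fun u hu v hv => (hmem _).2 fun w hw =>
    sup_le ((hmem u).1 hu w hw) ((hmem v).1 hv w hw)
  -- The image of the extent in the finite lattice B_(n,k) is closed under joins, so it has a
  -- greatest element. The bottom b, which exists for n ≥ 1, makes it nonempty.
  have hmax (k : ℕ) : ∃ w ∈ C.extent, ∀ v ∈ C.extent, proj n k v ≤ proj n k w := by
    have hfin : (proj n k '' C.extent).Finite := Set.toFinite _
    have hne : hfin.toFinset.Nonempty :=
      ⟨proj n k b, hfin.mem_toFinset.2 ⟨b, (hmem b).2 fun u _ => hb u, rfl⟩⟩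
    have hsc : SupClosed (proj n k '' C.extent) := hsup.image (proj n k)
    obtain ⟨w, hw, hwk⟩ := hsc.finsetSup'_mem (f := id) hne fun i hi => hfin.mem_toFinset.1 hi
    refine ⟨w, hw, fun v hv => ?_⟩
    rw [hwk]
    exact Finset.le_sup' id (hfin.mem_toFinset.2 ⟨v, hv, rfl⟩)
  choose w hw hwmax using hmax
  refine ⟨⟨fun k => proj n k (w k), fun k l h => ?_⟩, Concept.ext ?_⟩
  · change transition n h (proj n l (w l)) = proj n k (w k)
    refine le_antisymm (hwmax k _ (hw l)) ?_
    rw [← transition_proj n h (w k)]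
    exact OrderHomClass.mono _ (hwmax l _ (hw k))
  · refine Set.Subset.antisymm (fun v hv => (hmem v).2 fun u hu => ?_) fun v hv k => hwmax k v hv
    exact le_of_forall_proj_le fun k =>
      (hv k).trans (OrderHomClass.mono _ ((hmem (w k)).1 (hw k) u hu))

/-- The completion is the Dedekind-MacNeille completion of the free lattice. -/
noncomputable def orderIsoDedekindCut (hn : 1 ≤ n) :
    profiniteBoundedCompletion n ≃o DedekindCut (FreeLattice (Fin n)) :=
  RelIso.ofSurjective (OrderEmbedding.ofMapLEIff toDedekindCut toDedekindCut_le_iff)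
    (toDedekindCut_surjective hn)

theorem joinSemidistributive (n : ℕ) : JoinSemidistributive (profiniteBoundedCompletion n) := by
  intro x y z h
  refine Subtype.ext (funext fun k => ?_)
  exact joinSemidistributive_of_DSet (exists_mem_DSet n k) (x.1 k) (y.1 k) (z.1 k)
    (congrFun (congrArg Subtype.val h) k)

theorem meetSemidistributive (n : ℕ) : MeetSemidistributive (profiniteBoundedCompletion n) := by
  intro x y z h
  refine Subtype.ext (funext fun k => ?_)
  exact meetSemidistributive_of_dual
    (joinSemidistributive_of_DSet (exists_mem_DSet_dual n k)) (x.1 k) (y.1 k) (z.1 k)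
    (congrFun (congrArg Subtype.val h) k)

theorem whitmanCondition (n : ℕ) : WhitmanCondition (profiniteBoundedCompletion n) := by
  intro s t u v h
  by_contra! hn
  obtain ⟨k₁, h₁⟩ := exists_not_le hn.1
  obtain ⟨k₂, h₂⟩ := exists_not_le hn.2.1
  obtain ⟨k₃, h₃⟩ := exists_not_le hn.2.2.1
  obtain ⟨k₄, h₄⟩ := exists_not_le hn.2.2.2
  obtain ⟨k, hk₁, hk₂, hk₃, hk₄⟩ : ∃ k, k₁ ≤ k ∧ k₂ ≤ k ∧ k₃ ≤ k ∧ k₄ ≤ k :=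
    ⟨k₁ + k₂ + k₃ + k₄, by omega, by omega, by omega, by omega⟩
  obtain ⟨g, hg⟩ := FreeLattice.exists_lift_doubledInterval (s.1 k ⊓ t.1 k) (u.1 k ⊔ v.1 k)
    (proj n k)
  obtain ⟨j, hj⟩ := ((isFiniteBounded n k).doubledInterval (s.1 k ⊓ t.1 k)
    (u.1 k ⊔ v.1 k)).exists_inBoundedVariety
  -- At level `max j k` inequalities transfer along g, because the doubled lattice lies in V_j, and
  -- representatives still project to the components at level k.
  have hkl : k ≤ max j k := le_max_right j k
  obtain ⟨s', hs'⟩ := proj_surjective n (max j k) (s.1 _)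
  obtain ⟨t', ht'⟩ := proj_surjective n (max j k) (t.1 _)
  obtain ⟨u', hu'⟩ := proj_surjective n (max j k) (u.1 _)
  obtain ⟨v', hv'⟩ := proj_surjective n (max j k) (v.1 _)
  have hle : proj n (max j k) (s' ⊓ t') ≤ proj n (max j k) (u' ⊔ v') := by
    rw [map_inf, map_sup, hs', ht', hu', hv']
    exact h _
  have hgle := proj_le_proj_iff.1 hle _ (hj.mono (le_max_left j k)) g
  rw [map_inf, map_sup] at hgle
  refine DoubledInterval.not_inf_le_sup ?_ ?_ ?_ ?_ ?_ ?_ hgle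
  · rw [hg, hg, proj_eq_of_le s hkl hs', proj_eq_of_le t hkl ht']
  · rw [hg, hg, proj_eq_of_le u hkl hu', proj_eq_of_le v hkl hv']
  · rw [hg, proj_eq_of_le s hkl hs']; exact h₁ k hk₁
  · rw [hg, proj_eq_of_le t hkl ht']; exact h₂ k hk₂
  · rw [hg, proj_eq_of_le u hkl hu']; exact h₃ k hk₃
  · rw [hg, proj_eq_of_le v hkl hv']; exact h₄ k hk₄

end profiniteBoundedCompletion

/-! ### The failure of meet semidistributivity in the ideal lattice -/

section Zigzag

variable {L : Type*} [Lattice L] (x y z : L)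

theorem zigzag_le_succ (k : ℕ) : (zigzag x y z k).1 ≤ (zigzag x y z (k + 1)).1 ∧
    (zigzag x y z k).2 ≤ (zigzag x y z (k + 1)).2 := by
  induction k with
  | zero => exact ⟨le_sup_left, le_sup_left⟩
  | succ k ih =>
    exact ⟨sup_le_sup_left (inf_le_inf_left x ih.2) y, sup_le_sup_left (inf_le_inf_left x ih.1) z⟩

theorem monotone_zigzag_fst : Monotone fun k => (zigzag x y z k).1 :=
  monotone_nat_of_le_succ fun k => (zigzag_le_succ x y z k).1

theorem monotone_zigzag_snd : Monotone fun k => (zigzag x y z k).2 :=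
  monotone_nat_of_le_succ fun k => (zigzag_le_succ x y z k).2

end Zigzag

/-- The ideal generated by an increasing sequence. -/
def Order.Ideal.ofMonotone {L : Type*} [Lattice L] (s : ℕ → L) (hs : Monotone s) :
    Order.Ideal L where
  carrier := ⋃ k, Set.Iic (s k)
  lower' _ _ hba ha := by
    obtain ⟨k, hk⟩ := Set.mem_iUnion.1 ha
    exact Set.mem_iUnion.2 ⟨k, le_trans hba hk⟩
  nonempty' := ⟨s 0, Set.mem_iUnion.2 ⟨0, le_rfl⟩⟩
  directed' a ha b hb := by
    obtain ⟨k, hk⟩ := Set.mem_iUnion.1 ha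
    obtain ⟨l, hl⟩ := Set.mem_iUnion.1 hb
    exact ⟨s (max k l), Set.mem_iUnion.2 ⟨_, le_rfl⟩, le_trans hk (hs (le_max_left k l)),
      le_trans hl (hs (le_max_right k l))⟩

theorem Order.Ideal.mem_ofMonotone {L : Type*} [Lattice L] {s : ℕ → L} {hs : Monotone s} {a : L} :
    a ∈ Order.Ideal.ofMonotone s hs ↔ ∃ k, a ≤ s k := Set.mem_iUnion

namespace FreeLattice

variable {α : Type*} {a b c : α}

/-- Apply (W) to x ∧ (y ∨ z) ≤ y ∨ (x ∧ z_k). The alternatives x ≤ y_{k+1} and z ≤ y_{k+1} fail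
since generators are join prime, being below y fails directly, and being below x ∧ z_k contradicts
the induction hypothesis. -/
theorem not_inf_sup_le_zigzag (hab : a ≠ b) (hac : a ≠ c) (hbc : b ≠ c) (k : ℕ) :
    ¬ of a ⊓ (of b ⊔ of c) ≤ (zigzag (of a) (of b) (of c) k).1 ∧
      ¬ of a ⊓ (of b ⊔ of c) ≤ (zigzag (of a) (of b) (of c) k).2 := by
  have of_le_of {d e : α} : of d ≤ of e ↔ e = d := by rw [of_le_iff, lift_of]
  have hx (k : ℕ) : ¬ of a ≤ (zigzag (of a) (of b) (of c) k).1 ∧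
      ¬ of a ≤ (zigzag (of a) (of b) (of c) k).2 := by
    induction k with
    | zero => exact ⟨fun h => hab (of_le_of.1 h).symm, fun h => hac (of_le_of.1 h).symm⟩
    | succ k ih =>
      simp only [zigzag, of_le_sup_iff, le_inf_iff, of_le_of, true_and]
      exact ⟨fun h => h.elim (fun h => hab h.symm) ih.2, fun h => h.elim (fun h => hac h.symm) ih.1⟩
  have hz (k : ℕ) : ¬ of c ≤ (zigzag (of a) (of b) (of c) k).1 := by
    cases k with
    | zero => exact fun h => hbc (of_le_of.1 h)
    | succ k =>
      simp only [zigzag, of_le_sup_iff, le_inf_iff, of_le_of]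
      exact fun h => h.elim hbc fun h => hac h.1
  have hy (k : ℕ) : ¬ of b ≤ (zigzag (of a) (of b) (of c) k).2 := by
    cases k with
    | zero => exact fun h => hbc (of_le_of.1 h).symm
    | succ k =>
      simp only [zigzag, of_le_sup_iff, le_inf_iff, of_le_of]
      exact fun h => h.elim (fun h => hbc h.symm) fun h => hab h.1
  have base {d e : α} (hd : a ≠ d) (he : e ≠ d) : ¬ of a ⊓ of e ≤ of d := by
    rw [le_of_iff, map_inf, lift_of, lift_of, not_not]
    exact ⟨hd, he⟩
  have hb : ¬ of a ⊓ (of b ⊔ of c) ≤ of b := fun h =>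
    base hab hbc.symm ((inf_le_inf_left _ le_sup_right).trans h)
  have hc : ¬ of a ⊓ (of b ⊔ of c) ≤ of c := fun h =>
    base hac hbc ((inf_le_inf_left _ le_sup_left).trans h)
  induction k with
  | zero => exact ⟨hb, hc⟩
  | succ k ih =>
    constructor
    · intro h
      rcases whitmanCondition α _ _ _ _ h with h | h | h | h
      · exact (hx (k + 1)).1 h
      · exact hz (k + 1) (le_sup_right.trans h)
      · exact hb h
      · exact ih.2 (h.trans inf_le_right)
    · intro h
      rcases whitmanCondition α _ _ _ _ h with h | h | h | h
      · exact (hx (k + 1)).2 h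
      · exact hy (k + 1) (le_sup_left.trans h)
      · exact hc h
      · exact ih.1 (h.trans inf_le_right)

theorem exists_zigzag_ideals (hab : a ≠ b) (hac : a ≠ c) (hbc : b ≠ c)
    {x y z : FreeLattice α} (hx : x = of a) (hy : y = of b) (hz : z = of c) :
    ∃ X Y Z : Order.Ideal (FreeLattice α),
      X = Order.Ideal.principal x ∧
      (Y : Set (FreeLattice α)) = ⋃ k : ℕ, Set.Iic (zigzag x y z k).1 ∧
      (Z : Set (FreeLattice α)) = ⋃ k : ℕ, Set.Iic (zigzag x y z k).2 ∧
      X ⊓ Y = X ⊓ Z ∧ X ⊓ Y < X ⊓ (Y ⊔ Z) ∧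
      x ⊓ (y ⊔ z) ∈ X ⊓ (Y ⊔ Z) ∧ x ⊓ (y ⊔ z) ∉ X ⊓ Y ∧ x ⊓ (y ⊔ z) ∉ X ⊓ Z := by
  have hn := not_inf_sup_le_zigzag hab hac hbc
  rw [← hx, ← hy, ← hz] at hn
  let X := Order.Ideal.principal x
  let Y := Order.Ideal.ofMonotone _ (monotone_zigzag_fst x y z)
  let Z := Order.Ideal.ofMonotone _ (monotone_zigzag_snd x y z)
  have hmem : x ⊓ (y ⊔ z) ∈ X ⊓ (Y ⊔ Z) := Order.Ideal.mem_inf.2 ⟨inf_le_left (a := x),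
    Order.Ideal.mem_sup.2 ⟨y, Order.Ideal.mem_ofMonotone.2 ⟨0, le_rfl⟩, z,
      Order.Ideal.mem_ofMonotone.2 ⟨0, le_rfl⟩, inf_le_right⟩⟩
  have hY : x ⊓ (y ⊔ z) ∉ X ⊓ Y := fun h =>
    let ⟨k, hk⟩ := Order.Ideal.mem_ofMonotone.1 (Order.Ideal.mem_inf.1 h).2
    (hn k).1 hk
  have hZ : x ⊓ (y ⊔ z) ∉ X ⊓ Z := fun h =>
    let ⟨k, hk⟩ := Order.Ideal.mem_ofMonotone.1 (Order.Ideal.mem_inf.1 h).2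
    (hn k).2 hk
  refine ⟨X, Y, Z, rfl, rfl, rfl, ?_, ?_, hmem, hY, hZ⟩
  · ext w
    simp only [SetLike.mem_coe, Order.Ideal.mem_inf]
    refine and_congr_right fun hw => ⟨fun h => ?_, fun h => ?_⟩
    · obtain ⟨k, hk⟩ := Order.Ideal.mem_ofMonotone.1 h
      -- The sequences are built for this: w ≤ x and w ≤ y_k give w ≤ x ∧ y_k ≤ z_{k+1}.
      exact Order.Ideal.mem_ofMonotone.2 ⟨k + 1, le_sup_of_le_right (le_inf hw hk)⟩
    · obtain ⟨k, hk⟩ := Order.Ideal.mem_ofMonotone.1 h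
      exact Order.Ideal.mem_ofMonotone.2 ⟨k + 1, le_sup_of_le_right (le_inf hw hk)⟩
  · exact lt_of_le_of_ne (inf_le_inf_left X le_sup_left) fun h => hY (h ▸ hmem)

theorem not_meetSemidistributive_ideal (hab : a ≠ b) (hac : a ≠ c) (hbc : b ≠ c) :
    ¬ MeetSemidistributive (Order.Ideal (FreeLattice α)) := by
  intro h
  obtain ⟨X, Y, Z, -, -, -, heq, hlt, -⟩ := exists_zigzag_ideals hab hac hbc rfl rfl rfl
  exact hlt.ne (h X Y Z heq)

end FreeLattice

/-! ### The first-order sentence -/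

open FirstOrder Language in
/-- Meet semidistributivity as a first-order sentence. -/
def meetSemidistributiveSentence : latticeLanguage.Sentence :=
  let join : latticeLanguage.Functions 2 := LatticeFunc.sup
  let meet : latticeLanguage.Functions 2 := LatticeFunc.inf
  ∀' ∀' ∀' ((meet.apply₂ (&0) (&1) =' meet.apply₂ (&0) (&2)) ⟹
    (meet.apply₂ (&0) (&1) =' meet.apply₂ (&0) (join.apply₂ (&1) (&2))))

theorem realize_meetSemidistributiveSentence (L : Type*) [Lattice L] :
    FirstOrder.Language.Sentence.Realize L meetSemidistributiveSentence ↔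
      MeetSemidistributive L := by
  simp only [meetSemidistributiveSentence, FirstOrder.Language.Sentence.Realize,
    FirstOrder.Language.Formula.Realize, FirstOrder.Language.BoundedFormula.realize_all,
    FirstOrder.Language.BoundedFormula.realize_imp,
    FirstOrder.Language.BoundedFormula.realize_bdEqual]
  exact Iff.rfl

theorem mainTheorem4 :
    -- the ideal lattice of the free lattice
    (∀ n : ℕ, 1 ≤ n →
      WhitmanCondition (Order.Ideal (FreeLattice (Fin n))) ∧
      JoinSemidistributive (Order.Ideal (FreeLattice (Fin n)))) ∧
    (∀ n : ℕ, 3 ≤ n → ¬ MeetSemidistributive (Order.Ideal (FreeLattice (Fin n)))) ∧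
    -- the profinite-bounded completion, which is the Dedekind-MacNeille completion
    (∀ n : ℕ, 1 ≤ n →
      Nonempty (profiniteBoundedCompletion n ≃o DedekindCut (FreeLattice (Fin n))) ∧
      WhitmanCondition (profiniteBoundedCompletion n) ∧
      JoinSemidistributive (profiniteBoundedCompletion n) ∧
      MeetSemidistributive (profiniteBoundedCompletion n)) ∧
    -- the two are not elementarily equivalent
    (∀ n : ℕ, 3 ≤ n →
      ¬ latticeLanguage.ElementarilyEquivalent
        (Order.Ideal (FreeLattice (Fin n))) (DedekindCut (FreeLattice (Fin n)))) ∧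
    -- the explicit failure of meet semidistributivity in the ideal lattice of `F_3`
    (∀ x y z : FreeLattice (Fin 3),
      x = FreeLattice.of 0 → y = FreeLattice.of 1 → z = FreeLattice.of 2 →
      ∃ X Y Z : Order.Ideal (FreeLattice (Fin 3)),
        X = Order.Ideal.principal x ∧
        (Y : Set (FreeLattice (Fin 3))) = ⋃ k : ℕ, Set.Iic (zigzag x y z k).1 ∧
        (Z : Set (FreeLattice (Fin 3))) = ⋃ k : ℕ, Set.Iic (zigzag x y z k).2 ∧
        X ⊓ Y = X ⊓ Z ∧ X ⊓ Y < X ⊓ (Y ⊔ Z) ∧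
        x ⊓ (y ⊔ z) ∈ X ⊓ (Y ⊔ Z) ∧ x ⊓ (y ⊔ z) ∉ X ⊓ Y ∧ x ⊓ (y ⊔ z) ∉ X ⊓ Z) := by
  have distinct {n : ℕ} (hn : 3 ≤ n) : (⟨0, by omega⟩ : Fin n) ≠ ⟨1, by omega⟩ ∧
      (⟨0, by omega⟩ : Fin n) ≠ ⟨2, by omega⟩ ∧ (⟨1, by omega⟩ : Fin n) ≠ ⟨2, by omega⟩ := by
    simp
  have hfail (n : ℕ) (hn : 3 ≤ n) : ¬ MeetSemidistributive (Order.Ideal (FreeLattice (Fin n))) :=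
    FreeLattice.not_meetSemidistributive_ideal (distinct hn).1 (distinct hn).2.1 (distinct hn).2.2
  refine ⟨fun n _ => ⟨(FreeLattice.whitmanCondition _).ideal,
    joinSemidistributive_ideal_of_DSet FreeLattice.exists_mem_DSet_self⟩, hfail, fun n hn =>
    ⟨⟨profiniteBoundedCompletion.orderIsoDedekindCut hn⟩,
      profiniteBoundedCompletion.whitmanCondition n,
      profiniteBoundedCompletion.joinSemidistributive n,
      profiniteBoundedCompletion.meetSemidistributive n⟩, fun n hn h => hfail n hn ?_,
    fun x y z => FreeLattice.exists_zigzag_ideals (by decide) (by decide) (by decide)⟩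
  rw [← realize_meetSemidistributiveSentence]
  refine (FirstOrder.Language.elementarilyEquivalent_iff.1 h _).2 ?_
  rw [realize_meetSemidistributiveSentence]
  exact (profiniteBoundedCompletion.meetSemidistributive n).of_orderIso
    (profiniteBoundedCompletion.orderIsoDedekindCut (by omega))
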